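/- Let $p$ be a prime and let $R$ be a commutative Noetherian local pro-$p$ domain of characteristic $0$ with maximal ideal $\mathfrak m$ (pro-$p$ meaning: an inverse limit of finite rings of $p$-power order). Put $\mathbf p = 4$ if $p = 2$ and $\mathbf p = p$ if $p$ is odd. Let $G$ be an $R$-standard group of dimension $d \ge 0$ and level $1$: $G$ is identified, as a topological space, with $\mathfrak m^{(d)}$ (the product of $d$ copies of $\mathfrak m$), the neutral element is $(0,\dots,0)$, and the multiplication is $\mathbf x\cdot \mathbf y = (F_1(\mathbf x,\mathbf y),\dots,F_d(\mathbf x,\mathbf y))$ for a $d$-dimensional formal group law $\mathbf F=(F_1,\dots,F_d)$ over $R$. For an ideal $I \subseteq \mathfrak m$ write $G(I) = I^{(d)} \subseteq G$. Let $A = R[[x_1,\dots,x_d]]$, regarded as a ring of functions $G\to R$, let $(\lambda_{\mathbf x} f)(\mathbf y) = f(\mathbf x^{-1}\mathbf y)$ for $f\in A$ and $\mathbf x,\mathbf y\in G$, and let $L(G)$ be the Lie $R$-algebra (under the commutator bracket) of all $R$-derivations $w$ of $A$ with $w\lambda_{\mathbf x} = \lambda_{\mathbf x} w$ for all $\mathbf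 x\in G$. Suppose that, for some finitely generated torsion-free $R$-module $W$, there is an injective homomorphism of Lie $R$-algebras $L(G) \to \operatorname{End}_R(W)^{(-)}$, where $\operatorname{End}_R(W)^{(-)}$ is $\operatorname{End}_R(W)$ with the bracket $[a,b]=ab-ba$. Then $G(\mathbf pR)$ is a subgroup of $G$, and it embeds as a closed subgroup of $\operatorname{Aut}_R(W)$ for the same $W$: there is a group homomorphism $G(\mathbf pR)\to \operatorname{Aut}_R(W)$ that is a homeomorphism onto a closed subset. Here $\operatorname{Aut}_R(W)$ carries its congruence topology, in which the sets $\{h : (h-g)W\subseteq \mathfrak m^kW\}$, $k\ge 0$, form a basis of neighbourhoods of $g$. -/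

import Mathlib

open scoped Topology

/- For an associative ring `A`, this is the Lie ring `A^(-)`, with bracket `a * b - b * a`. -/
attribute [local instance] LieRing.ofAssociativeRing

/-- A topological commutative ring is a pro-`p` ring if it is the inverse limit of finite discrete
rings of `p`-power order, i.e. if it is compact, Hausdorff, and `0` has a basis of neighbourhoods
consisting of open ideals whose quotients have `p`-power order. -/
structure IsProPRing (p : ℕ) (R : Type*) [CommRing R] [TopologicalSpace R]
    [IsTopologicalRing R] : Prop where
  compactSpace : CompactSpace R
  t2Space : T2Space R
  exists_ideal : ∀ U ∈ 𝓝 (0 : R), ∃ I : Ideal R,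
    IsOpen (I : Set R) ∧ (I : Set R) ⊆ U ∧ ∃ n : ℕ, Nat.card (R ⧸ I) = p ^ n

/-- A `d`-dimensional formal group law over `R`: a `d`-tuple `F` of power series in `2d` variables
`(X, Y)` with `F(X, 0) = X`, `F(0, Y) = Y` and `F(F(X, Y), Z) = F(X, F(Y, Z))`.
The variables `X` are indexed by the left summand and the variables `Y` by the right one. -/
structure IsFormalGroupLaw {R : Type*} [CommRing R] {d : ℕ}
    (F : Fin d → MvPowerSeries (Fin d ⊕ Fin d) R) : Prop where
  right_zero : ∀ i, MvPowerSeries.subst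
    (Sum.elim MvPowerSeries.X 0 : Fin d ⊕ Fin d → MvPowerSeries (Fin d) R) (F i) =
      MvPowerSeries.X i
  left_zero : ∀ i, MvPowerSeries.subst
    (Sum.elim 0 MvPowerSeries.X : Fin d ⊕ Fin d → MvPowerSeries (Fin d) R) (F i) =
      MvPowerSeries.X i
  assoc : ∀ i,
    MvPowerSeries.subst
      (Sum.elim
        (fun j => MvPowerSeries.subst
          (Sum.elim (fun a => MvPowerSeries.X (Sum.inl a))
            (fun a => MvPowerSeries.X (Sum.inr (Sum.inl a)))) (F j))
        (fun a => MvPowerSeries.X (Sum.inr (Sum.inr a))) :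
        Fin d ⊕ Fin d → MvPowerSeries (Fin d ⊕ (Fin d ⊕ Fin d)) R) (F i) =
    MvPowerSeries.subst
      (Sum.elim
        (fun a => MvPowerSeries.X (Sum.inl a))
        (fun j => MvPowerSeries.subst
          (Sum.elim (fun a => MvPowerSeries.X (Sum.inr (Sum.inl a)))
            (fun a => MvPowerSeries.X (Sum.inr (Sum.inr a)))) (F j)) :
        Fin d ⊕ Fin d → MvPowerSeries (Fin d ⊕ (Fin d ⊕ Fin d)) R) (F i)

/-- The power series `f` converges at the point `a`, with value `r`. -/
def HasValueAt {R : Type*} [CommRing R] [TopologicalSpace R] {σ : Type*}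
    (f : MvPowerSeries σ R) (a : σ → R) (r : R) : Prop :=
  HasSum (fun n : σ →₀ ℕ => MvPowerSeries.coeff n f * n.prod fun i e => a i ^ e) r

/-- The structure of an `R`-standard group of dimension `d` and level `1` on a topological group
`G`: a global chart identifying `G` with `𝔪 ^ d` (`𝔪` the maximal ideal of `R`), under which the
neutral element is `0` and the multiplication is given by a formal group law. -/
structure StandardGroup (R : Type*) [CommRing R] [IsLocalRing R] [TopologicalSpace R] (d : ℕ)
    (G : Type*) [Group G] [TopologicalSpace G] where
  law : Fin d → MvPowerSeries (Fin d ⊕ Fin d) R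
  isFormalGroupLaw : IsFormalGroupLaw law
  chart : G ≃ₜ (Fin d → IsLocalRing.maximalIdeal R)
  chart_one : chart 1 = 0
  chart_mul : ∀ (x y : G) (i : Fin d),
    HasValueAt (law i) (Sum.elim (fun j => (chart x j : R)) (fun j => (chart y j : R)))
      (chart (x * y) i : R)

namespace StandardGroup

variable {R : Type*} [CommRing R] [IsLocalRing R] [TopologicalSpace R] {d : ℕ}
  {G : Type*} [Group G] [TopologicalSpace G]

/-- The subset `G(I)` of `G` of the points all of whose coordinates lie in the ideal `I`. -/
def points (S : StandardGroup R d G) (I : Ideal R) : Set G :=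
  {x | ∀ i, (S.chart x i : R) ∈ I}

/-- The element `f` of `A = R⟦x₁, …, x_d⟧`, viewed as a function on `G`, has value `r` at `y`. -/
def HasValue (S : StandardGroup R d G) (f : MvPowerSeries (Fin d) R) (y : G) (r : R) : Prop :=
  HasValueAt f (fun i => (S.chart y i : R)) r

/-- `g = λ_x f` as functions on `G`, that is, `g(y) = f(x⁻¹ y)` for all `y ∈ G`. -/
def IsLeftTranslate (S : StandardGroup R d G) (x : G) (f g : MvPowerSeries (Fin d) R) : Prop :=
  ∀ y : G, ∃ r : R, S.HasValue f (x⁻¹ * y) r ∧ S.HasValue g y r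

theorem HasValue.add [IsTopologicalRing R] {S : StandardGroup R d G}
    {f g : MvPowerSeries (Fin d) R} {y : G} {r s : R}
    (hf : S.HasValue f y r) (hg : S.HasValue g y s) : S.HasValue (f + g) y (r + s) := by
  simpa only [HasValue, HasValueAt, map_add, add_mul] using HasSum.add hf hg

theorem HasValue.smul [IsTopologicalRing R] {S : StandardGroup R d G}
    {f : MvPowerSeries (Fin d) R} {y : G} {r : R} (c : R)
    (hf : S.HasValue f y r) : S.HasValue (c • f) y (c * r) := by
  simpa only [HasValue, HasValueAt, map_smul, smul_eq_mul, mul_assoc] using HasSum.mul_left c hf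

theorem IsLeftTranslate.zero (S : StandardGroup R d G) (x : G) : S.IsLeftTranslate x 0 0 := by
  intro y
  refine ⟨0, ?_, ?_⟩ <;> simp [HasValue, HasValueAt, hasSum_zero]

theorem IsLeftTranslate.add [IsTopologicalRing R] {S : StandardGroup R d G} {x : G}
    {f f' g g' : MvPowerSeries (Fin d) R} (h : S.IsLeftTranslate x f g)
    (h' : S.IsLeftTranslate x f' g') : S.IsLeftTranslate x (f + f') (g + g') := by
  intro y
  obtain ⟨r, h1, h2⟩ := h y
  obtain ⟨s, h3, h4⟩ := h' y
  exact ⟨r + s, h1.add h3, h2.add h4⟩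

theorem IsLeftTranslate.smul [IsTopologicalRing R] {S : StandardGroup R d G} {x : G}
    {f g : MvPowerSeries (Fin d) R} (c : R) (h : S.IsLeftTranslate x f g) :
    S.IsLeftTranslate x (c • f) (c • g) := by
  intro y
  obtain ⟨r, h1, h2⟩ := h y
  exact ⟨c * r, h1.smul c, h2.smul c⟩

/-- The Lie algebra `L(G)`: the `R`-derivations `w` of `A = R⟦x₁, …, x_d⟧` that commute with all
left translations, `w (λ_x f) = λ_x (w f)`, under the commutator bracket. -/
noncomputable def lieAlgebra [IsTopologicalRing R] (S : StandardGroup R d G) :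
    LieSubalgebra R
      (Derivation R (MvPowerSeries (Fin d) R) (MvPowerSeries (Fin d) R)) where
  carrier := {w | ∀ (x : G) (f g : MvPowerSeries (Fin d) R),
    S.IsLeftTranslate x f g → S.IsLeftTranslate x (w f) (w g)}
  zero_mem' := fun x _ _ _ => IsLeftTranslate.zero S x
  add_mem' := fun hv hw x f g h => (hv x f g h).add (hw x f g h)
  smul_mem' := fun c _ hw x f g h => (hw x f g h).smul c
  lie_mem' := fun {v w} hv hw x f g h => by
    have h1 := hv x _ _ (hw x f g h)
    have h2 := (hw x _ _ (hv x f g h)).smul (-1 : R)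
    simpa [Derivation.commutator_apply, sub_eq_add_neg] using h1.add h2

end StandardGroup

/-- The number `𝐩`: it is `4` if `p = 2`, and `p` otherwise. -/
def boldP (p : ℕ) : ℕ := if p = 2 then 4 else p

/-- The congruence topology on `Aut_R(W)`, `R` a local ring with maximal ideal `𝔪`: the coarsest
topology for which every reduction `g ↦ g mod 𝔪 ^ k W` is locally constant. Thus a basis of
neighbourhoods of `g` is given by the sets `{h | (h - g) W ⊆ 𝔪 ^ k W}`. -/
@[reducible] def autTopology (R : Type*) [CommRing R] [IsLocalRing R] (W : Type*) [AddCommGroup W]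
    [Module R W] : TopologicalSpace (W ≃ₗ[R] W) :=
  ⨅ k : ℕ, TopologicalSpace.induced
    (fun (g : W ≃ₗ[R] W) (w : W) =>
      (Submodule.Quotient.mk (g w) :
        W ⧸ (IsLocalRing.maximalIdeal R ^ k • (⊤ : Submodule R W)))) ⊥

/-! Expand `f(F(X, Y))` in powers of `Y`. The coefficient of `Y ^ γ` is a left-invariant operator
`D_γ` (`invOp γ`) on `A`, and associativity of `F` gives `D_β D_γ = ∑ c(α; β, γ) D_α`, where `c(α;
β, γ)` is the coefficient of `X ^ β Y ^ γ` in `F ^ α`. The multiples `γ! D_γ` (`powOp`) act as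
ordered monomials in an enveloping algebra of the Lie algebra spanned by the derivations `D_i =
D_{e_i}`: they are linearly independent, and multiplying by `D_i` adds `e_i` to the index up to
terms of lower degree, with all coefficients in `R` (`powOp_mul_sub_mem`).

Given `ι`, form the pairs `(D_i, ι D_i)` in `End(A) × End(W)`. A Poincaré–Birkhoff–Witt argument
shows that the algebra they generate projects injectively to the first factor. Lifting `γ! D_γ` and
taking second components gives `ρ γ` in `End(W)` that multiply with constants `e(α; β, γ)` in `R`
satisfying `β! γ! c = α! e` (`exists_extension`).

Then `Φ(x) = ∑ (x ^ α / α!) ρ α` is formally multiplicative, because `(xy) ^ α = ∑ c(α; β, γ) x ^ β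
y ^ γ`. On `G(𝐩R)` Legendre's formula puts the quotients `x ^ α / α!` in `R` and makes them tend to
zero, which is why `𝐩 = 4` for `p = 2` (`exists_hom`).

For injectivity, let `Φ(x) = 1` and `x = p ^ j y₀`. The `ρ e_i` are independent over `R` but perhaps
not modulo `p`, so the first-order term of `Φ(x)` alone decides nothing. All powers of `x` are in
the kernel too, and `x ^ (p ^ n) = p ^ (j + n) y` with `y ≡ y₀` mod `p`. As the first-order term
dominates, `∑ y_i ρ e_i` is divisible by `p ^ n`. By compactness some `y ≡ y₀` satisfies the
relation exactly, so `y = 0` and `p ∣ y₀`. Hence every power of `p` divides `x`, and `x` is trivial.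
A continuous injection of a compact space into a Hausdorff one is a closed embedding. -/

set_option linter.unusedSectionVars false

/-! ### Power series in two groups of variables: partial coefficients and substitution. -/

namespace MvPowerSeries

open Finsupp

variable {R : Type*} [CommRing R] {σ τ ρ κ : Type*}

/-- The series in `σ` formed by the coefficients of `h` at `γ` in the right variables. -/
def coeffRight (γ : τ →₀ ℕ) : MvPowerSeries (σ ⊕ τ) R →ₗ[R] MvPowerSeries σ R where
  toFun h := fun β => coeff (β.sumElim γ) h
  map_add' _ _ := rfl
  map_smul' _ _ := rfl

/-- The series in `τ` formed by the coefficients of `h` at `β` in the left variables. -/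
def coeffLeft (β : σ →₀ ℕ) : MvPowerSeries (σ ⊕ τ) R →ₗ[R] MvPowerSeries τ R where
  toFun h := fun γ => coeff (β.sumElim γ) h
  map_add' _ _ := rfl
  map_smul' _ _ := rfl

@[simp] theorem coeff_coeffRight (γ : τ →₀ ℕ) (β : σ →₀ ℕ) (h : MvPowerSeries (σ ⊕ τ) R) :
    coeff β (coeffRight γ h) = coeff (β.sumElim γ) h := rfl

@[simp] theorem coeff_coeffLeft (γ : τ →₀ ℕ) (β : σ →₀ ℕ) (h : MvPowerSeries (σ ⊕ τ) R) :
    coeff γ (coeffLeft β h) = coeff (β.sumElim γ) h := rfl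

theorem finsum_eq_of_support_subset_range {α β M : Type*} [AddCommMonoid M] {f : α → M} {e : β → α}
    (he : Function.Injective e) (hf : ∀ a, a ∉ Set.range e → f a = 0) :
    ∑ᶠ a, f a = ∑ᶠ b, f (e b) := by
  rw [← finsum_mem_range he, finsum_mem_def]
  refine finsum_congr fun a => ?_
  by_cases h : a ∈ Set.range e
  · simp [h]
  · rw [Set.indicator_of_notMem h, hf a h]

theorem subst_sumElim_X_zero [Finite σ] [Finite τ] (h : MvPowerSeries (σ ⊕ τ) R) :
    subst (Sum.elim X 0 : σ ⊕ τ → MvPowerSeries σ R) h = coeffRight 0 h := by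
  classical
  have hs : HasSubst (Sum.elim X 0 : σ ⊕ τ → MvPowerSeries σ R) :=
    hasSubst_of_constantCoeff_zero (by rintro (i | i) <;> simp)
  ext β
  rw [coeff_subst hs, finsum_eq_single _ (β.sumElim 0)]
  · rw [prod_sumElim]
    have : (β.prod ((fun s e => (Sum.elim X 0 : σ ⊕ τ → MvPowerSeries σ R) s ^ e) ∘ Sum.inl)) =
      monomial β 1 := by
      rw [monomial_eq']; simp [Function.comp_def]
    rw [this]; simp
  · intro n hn
    rw [← comapDomain_sumElim_comapDomain n, prod_sumElim] at *
    set a := comapDomain Sum.inl n Sum.inl_injective.injOn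
    set b := comapDomain Sum.inr n Sum.inr_injective.injOn
    have : (a.prod ((fun s e => (Sum.elim X 0 : σ ⊕ τ → MvPowerSeries σ R) s ^ e) ∘ Sum.inl)) =
      monomial a 1 := by
      rw [monomial_eq']; simp [Function.comp_def]
    rw [this]
    by_cases hb : b = 0
    · have : β ≠ a := by rintro rfl; exact hn (by rw [hb])
      simp [hb, coeff_monomial, this]
    · obtain ⟨i, hi⟩ := Finsupp.ne_iff.mp hb
      rw [Finsupp.prod, Finset.prod_eq_zero (i := i) (by simpa using hi)]
      · simp
      · simpa using zero_pow hi

theorem subst_sumElim_zero_X [Finite σ] [Finite τ] (h : MvPowerSeries (σ ⊕ τ) R) :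
    subst (Sum.elim 0 X : σ ⊕ τ → MvPowerSeries τ R) h = coeffLeft 0 h := by
  classical
  have hs : HasSubst (Sum.elim 0 X : σ ⊕ τ → MvPowerSeries τ R) :=
    hasSubst_of_constantCoeff_zero (by rintro (i | i) <;> simp)
  ext β
  rw [coeff_subst hs, finsum_eq_single _ ((0 : σ →₀ ℕ).sumElim β)]
  · rw [prod_sumElim]
    have : (β.prod ((fun s e => (Sum.elim 0 X : σ ⊕ τ → MvPowerSeries τ R) s ^ e) ∘ Sum.inr)) =
      monomial β 1 := by
      rw [monomial_eq']; simp [Function.comp_def]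
    rw [this]; simp
  · intro n hn
    rw [← comapDomain_sumElim_comapDomain n, prod_sumElim] at *
    set a := comapDomain Sum.inl n Sum.inl_injective.injOn
    set b := comapDomain Sum.inr n Sum.inr_injective.injOn
    have : (b.prod ((fun s e => (Sum.elim 0 X : σ ⊕ τ → MvPowerSeries τ R) s ^ e) ∘ Sum.inr)) =
      monomial b 1 := by
      rw [monomial_eq']; simp [Function.comp_def]
    rw [this]
    by_cases hb : a = 0
    · have : β ≠ b := by rintro rfl; exact hn (by rw [hb])
      simp [hb, coeff_monomial, this]
    · obtain ⟨i, hi⟩ := Finsupp.ne_iff.mp hb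
      rw [Finsupp.prod, Finset.prod_eq_zero (i := i) (by simpa using hi)]
      · simp
      · simpa using zero_pow hi

theorem coeff_rename_mul_monomial (e₁ : ρ ↪ κ) (e₂ : τ ↪ κ) (hd : ∀ i j, e₁ i ≠ e₂ j)
    (h : MvPowerSeries ρ R) (m δ : τ →₀ ℕ) (ε : ρ →₀ ℕ) [Decidable (m = δ)] :
    coeff (embDomain e₁ ε + embDomain e₂ δ) (rename e₁ h * monomial (embDomain e₂ m) 1) =
      if m = δ then coeff ε h else 0 := by
  classical
  rw [coeff_mul_monomial]
  split_ifs with h1 h2 h2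
  · subst h2; simp
  · rw [coeff_rename_eq_zero, zero_mul]
    rintro ⟨x, hx⟩
    refine h2 (Finsupp.ext fun j => ?_)
    have hle := h1 (e₂ j)
    have hx' := DFunLike.congr_fun hx (e₂ j)
    have hn : e₂ j ∉ Set.range e₁ := by rintro ⟨i, hi⟩; exact hd i j hi
    rw [Finsupp.mapDomain_of_notMem_range _ _ hn] at hx'
    simp only [Finsupp.coe_tsub, Finsupp.coe_add, Pi.sub_apply, Pi.add_apply,
      embDomain_apply_self, embDomain_of_notMem_range _ _ _ hn] at hx' hle
    omega
  · subst h2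
    exact absurd le_add_self h1
  · rfl

theorem prod_pow_X_embDomain (e : τ ↪ κ) (m : τ →₀ ℕ) :
    (m.prod fun s k => (X (e s) : MvPowerSeries κ R) ^ k) = monomial (embDomain e m) 1 := by
  classical
  rw [monomial_eq', embDomain_eq_mapDomain, Finsupp.prod_mapDomain_index_inj e.injective]
  simp

theorem prod_pow_rename (e : ρ ↪ κ) (a : σ → MvPowerSeries ρ R) (m : σ →₀ ℕ) :
    (m.prod fun s k => (rename e (a s)) ^ k) = rename e (m.prod fun s k => a s ^ k) := by
  simp [Finsupp.prod]

/-- The variables `e₂ j` are left alone and do not occur in the substituted series, so only the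
monomials with exponent exactly `δ` in the second group contribute. This lemma and its mirror image
compute the two sides of associativity. -/
theorem coeff_subst_sumElim_rename_X [Finite σ] [Finite τ] (e₁ : ρ ↪ κ) (e₂ : τ ↪ κ)
    (hd : ∀ i j, e₁ i ≠ e₂ j) {a : σ → MvPowerSeries ρ R} (ha : ∀ i, constantCoeff (a i) = 0)
    (g : MvPowerSeries (σ ⊕ τ) R) (ε : ρ →₀ ℕ) (δ : τ →₀ ℕ) :
    coeff (embDomain e₁ ε + embDomain e₂ δ)
      (subst (Sum.elim (fun i => rename e₁ (a i)) (fun j => X (e₂ j))) g) =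
    coeff ε (subst a (coeffRight δ g)) := by
  classical
  rw [coeff_subst (hasSubst_of_constantCoeff_zero (by rintro (i | i) <;> simp [ha])),
    coeff_subst (hasSubst_of_constantCoeff_zero ha)]
  rw [finsum_eq_of_support_subset_range (e := fun m : σ →₀ ℕ => m.sumElim δ)]
  · refine finsum_congr fun m => ?_
    rw [prod_sumElim]
    simp only [Function.comp_def, Sum.elim_inl, Sum.elim_inr]
    rw [prod_pow_X_embDomain, prod_pow_rename, coeff_rename_mul_monomial _ _ hd, if_pos rfl]
    rfl
  · intro m m' h
    ext i; simpa using DFunLike.congr_fun h (Sum.inl i)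
  · intro n hn
    rw [← comapDomain_sumElim_comapDomain n] at *
    rw [prod_sumElim]
    simp only [Function.comp_def, Sum.elim_inl, Sum.elim_inr]
    rw [prod_pow_X_embDomain, prod_pow_rename, coeff_rename_mul_monomial _ _ hd, if_neg, smul_zero]
    intro h
    exact hn ⟨_, by rw [← h]⟩

theorem coeff_subst_sumElim_X_rename [Finite σ] [Finite τ] (e₁ : ρ ↪ κ) (e₂ : τ ↪ κ)
    (hd : ∀ i j, e₁ i ≠ e₂ j) {a : σ → MvPowerSeries ρ R} (ha : ∀ i, constantCoeff (a i) = 0)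
    (g : MvPowerSeries (τ ⊕ σ) R) (ε : ρ →₀ ℕ) (δ : τ →₀ ℕ) :
    coeff (embDomain e₁ ε + embDomain e₂ δ)
      (subst (Sum.elim (fun j => X (e₂ j)) (fun i => rename e₁ (a i))) g) =
    coeff ε (subst a (coeffLeft δ g)) := by
  classical
  rw [coeff_subst (hasSubst_of_constantCoeff_zero (by rintro (i | i) <;> simp [ha])),
    coeff_subst (hasSubst_of_constantCoeff_zero ha)]
  rw [finsum_eq_of_support_subset_range (e := fun m : σ →₀ ℕ => δ.sumElim m)]
  · refine finsum_congr fun m => ?_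
    rw [prod_sumElim, mul_comm]
    simp only [Function.comp_def, Sum.elim_inl, Sum.elim_inr]
    rw [prod_pow_X_embDomain, prod_pow_rename, coeff_rename_mul_monomial _ _ hd, if_pos rfl]
    rfl
  · intro m m' h
    ext i; simpa using DFunLike.congr_fun h (Sum.inr i)
  · intro n hn
    rw [← comapDomain_sumElim_comapDomain n] at *
    rw [prod_sumElim, mul_comm]
    simp only [Function.comp_def, Sum.elim_inl, Sum.elim_inr]
    rw [prod_pow_X_embDomain, prod_pow_rename, coeff_rename_mul_monomial _ _ hd, if_neg, smul_zero]
    intro h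
    exact hn ⟨_, by rw [← h]⟩

end MvPowerSeries

open MvPowerSeries Finsupp in
theorem MvPowerSeries.prod_pow_X {R σ : Type*} [CommRing R] (m : σ →₀ ℕ) :
    (m.prod fun s k => (X s : MvPowerSeries σ R) ^ k) = monomial m 1 := by
  rw [monomial_eq']; simp

/-! ### Left-invariant operators of a formal group law. -/

namespace IsFormalGroupLaw

open MvPowerSeries Finsupp

variable {R : Type*} [CommRing R] {d : ℕ} {F : Fin d → MvPowerSeries (Fin d ⊕ Fin d) R}

theorem coeffRight_zero (hF : IsFormalGroupLaw F) (i : Fin d) : coeffRight 0 (F i) = X i := by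
  rw [← subst_sumElim_X_zero, hF.right_zero]

theorem coeffLeft_zero (hF : IsFormalGroupLaw F) (i : Fin d) : coeffLeft 0 (F i) = X i := by
  rw [← subst_sumElim_zero_X, hF.left_zero]

theorem constantCoeff_eq_zero (hF : IsFormalGroupLaw F) (i : Fin d) : constantCoeff (F i) = 0 := by
  have := congrArg (coeff 0) (hF.coeffRight_zero i)
  simpa using this

theorem hasSubst (hF : IsFormalGroupLaw F) : HasSubst F :=
  hasSubst_of_constantCoeff_zero hF.constantCoeff_eq_zero

/-- The comultiplication `f(X) ↦ f(F(X, Y))`. -/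
noncomputable def comul (hF : IsFormalGroupLaw F) :
    MvPowerSeries (Fin d) R →ₐ[R] MvPowerSeries (Fin d ⊕ Fin d) R :=
  substAlgHom hF.hasSubst

/-- The left-invariant differential operator sending `f(X)` to the coefficient of `Y ^ γ` in
`f(F(X, Y))`. -/
noncomputable def invOp (hF : IsFormalGroupLaw F) (γ : Fin d →₀ ℕ) :
    Module.End R (MvPowerSeries (Fin d) R) :=
  coeffRight γ ∘ₗ hF.comul.toLinearMap

theorem coeff_invOp (hF : IsFormalGroupLaw F) (β γ : Fin d →₀ ℕ) (f : MvPowerSeries (Fin d) R) :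
    coeff β (hF.invOp γ f) = coeff (β.sumElim γ) (hF.comul f) := rfl

theorem invOp_apply (hF : IsFormalGroupLaw F) (γ : Fin d →₀ ℕ) (f : MvPowerSeries (Fin d) R) :
    hF.invOp γ f = coeffRight γ (hF.comul f) := rfl

theorem invOp_zero (hF : IsFormalGroupLaw F) : hF.invOp 0 = 1 := by
  refine LinearMap.ext fun f => ?_
  rw [invOp_apply, ← subst_sumElim_X_zero, comul, coe_substAlgHom, subst_comp_subst_apply hF.hasSubst]
  · simp only [hF.right_zero]
    exact congrFun subst_self f
  · exact hasSubst_of_constantCoeff_zero (by rintro (i | i) <;> simp)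

/-- Since `F(0, Y) = Y`, the operators followed by evaluation at the origin are dual to the
monomials. Linear independence and all comparisons of structure constants rest on this. -/
theorem coeff_zero_invOp (hF : IsFormalGroupLaw F) (γ : Fin d →₀ ℕ)
    (f : MvPowerSeries (Fin d) R) : coeff 0 (hF.invOp γ f) = coeff γ f := by
  rw [coeff_invOp, ← coeff_coeffLeft, ← subst_sumElim_zero_X, comul, coe_substAlgHom,
    subst_comp_subst_apply hF.hasSubst]
  · simp only [hF.left_zero]
    exact congrArg (coeff γ) (congrFun subst_self f)
  · exact hasSubst_of_constantCoeff_zero (by rintro (i | i) <;> simp)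

/-- The inclusion of the first two among three groups of variables. -/
def embFirstTwo (d : ℕ) : Fin d ⊕ Fin d ↪ Fin d ⊕ (Fin d ⊕ Fin d) where
  toFun := Sum.elim Sum.inl (fun a => Sum.inr (Sum.inl a))
  inj' := by rintro (a | a) (b | b) h <;> simp at h <;> rw [h]

/-- Both sides are the coefficient of `X ^ δ Y ^ β Z ^ γ`: on the left in `f(F(F(X, Y), Z))`, on the
right in `f(F(X, F(Y, Z)))`. -/
theorem comul_invOp (hF : IsFormalGroupLaw F) (δ β γ : Fin d →₀ ℕ)
    (f : MvPowerSeries (Fin d) R) :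
    coeff δ (hF.invOp β (hF.invOp γ f)) =
      coeff (β.sumElim γ) (hF.comul (coeffLeft δ (hF.comul f))) := by
  let e₁ := embFirstTwo d
  let e₂ : Fin d ↪ Fin d ⊕ (Fin d ⊕ Fin d) := ⟨fun j => Sum.inr (Sum.inr j), fun a b h => by simpa using! h⟩
  have h1 := coeff_subst_sumElim_rename_X e₁ e₂
    (by
      rintro (i | i) j h
      · exact Sum.inl_ne_inr h
      · exact Sum.inl_ne_inr (Sum.inr_injective h))
    hF.constantCoeff_eq_zero (hF.comul f) (δ.sumElim β) γ
  have h2 := coeff_subst_sumElim_X_rename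
    (Function.Embedding.inr : Fin d ⊕ Fin d ↪ Fin d ⊕ (Fin d ⊕ Fin d))
    Function.Embedding.inl (by simp)
    hF.constantCoeff_eq_zero (hF.comul f) (β.sumElim γ) δ
  rw [coeff_invOp, invOp_apply, comul, coe_substAlgHom] at *
  rw [← h1, ← h2]
  have hN : embDomain e₁ (δ.sumElim β) + embDomain e₂ γ =
      embDomain Function.Embedding.inr (β.sumElim γ) + embDomain Function.Embedding.inl δ := by
    rw [embDomain_inl, embDomain_inr, ← sumElim_add, zero_add, add_zero]
    simp only [embDomain_eq_mapDomain, sumElim_eq_add, mapDomain_add, ← mapDomain_comp, add_assoc]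
    rfl
  rw [hN, subst_comp_subst_apply hF.hasSubst, subst_comp_subst_apply hF.hasSubst]
  · have hl : ∀ j, rename e₁ (F j) = subst (Sum.elim (fun a => X (Sum.inl a))
        (fun a => X (Sum.inr (Sum.inl a)))) (F j) := fun j => by
      rw [rename_eq_subst]
      congr 1
      funext x
      rcases x with a | a <;> rfl
    have hr : ∀ j, rename (Function.Embedding.inr : Fin d ⊕ Fin d ↪ Fin d ⊕ (Fin d ⊕ Fin d)) (F j) =
        subst (Sum.elim (fun a => X (Sum.inr (Sum.inl a)))
        (fun a => X (Sum.inr (Sum.inr a)))) (F j) := fun j => by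
      rw [rename_eq_subst]
      congr 1
      funext x
      rcases x with a | a <;> rfl
    simp only [hl, hr]
    exact congrArg (fun a => coeff _ (subst a f)) (funext hF.assoc)
  · exact hasSubst_of_constantCoeff_zero
      (by rintro (i | i) <;> simp [hF.constantCoeff_eq_zero])
  · exact hasSubst_of_constantCoeff_zero
      (by rintro (i | i) <;> simp [hF.constantCoeff_eq_zero])

theorem finite_structure (hF : IsFormalGroupLaw F) (β γ : Fin d →₀ ℕ) :
    {α : Fin d →₀ ℕ | coeff β (hF.invOp γ (monomial α 1)) ≠ 0}.Finite := by
  have := coeff_subst_finite hF.hasSubst (fun _ => (1 : R) : MvPowerSeries (Fin d) R)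
    (β.sumElim γ)
  refine this.subset fun α hα => ?_
  simp only [Function.mem_support]
  rw [Set.mem_ofPred_eq, coeff_invOp, comul, substAlgHom_monomial, map_one, one_mul] at hα
  rwa [show coeff α (fun _ => (1 : R) : MvPowerSeries (Fin d) R) = 1 from rfl, one_smul]

theorem coeff_invOp_invOp (hF : IsFormalGroupLaw F) (δ β γ : Fin d →₀ ℕ)
    (f : MvPowerSeries (Fin d) R) :
    coeff δ (hF.invOp β (hF.invOp γ f)) =
      ∑ᶠ α, coeff δ (hF.invOp α f) * coeff β (hF.invOp γ (monomial α 1)) := by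
  rw [comul_invOp]
  conv_lhs => rw [comul, coe_substAlgHom, coeff_subst hF.hasSubst]
  refine finsum_congr fun α => ?_
  rw [coeff_invOp hF β γ, comul, substAlgHom_monomial, map_one, one_mul, smul_eq_mul,
    coeff_invOp, comul, coe_substAlgHom, coeff_coeffLeft]

/-- The structure constants are the coefficients of `X ^ β Y ^ γ` in `F ^ α`; the sum is finite
because `F` has no constant term. -/
theorem invOp_mul_invOp (hF : IsFormalGroupLaw F) (β γ : Fin d →₀ ℕ) :
    hF.invOp β * hF.invOp γ = ∑ α ∈ (hF.finite_structure β γ).toFinset,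
      coeff β (hF.invOp γ (monomial α 1)) • hF.invOp α := by
  refine LinearMap.ext fun f => MvPowerSeries.ext fun δ => ?_
  rw [Module.End.mul_apply, coeff_invOp_invOp, finsum_eq_sum_of_support_subset
    (s := (hF.finite_structure β γ).toFinset)]
  · rw [LinearMap.sum_apply, map_sum]
    simp [mul_comm]
  · intro α hα
    simp only [Function.mem_support] at hα
    simpa using right_ne_zero_of_mul hα

/-- The left-invariant derivation attached to the `i`-th coordinate. -/
noncomputable def der (hF : IsFormalGroupLaw F) (i : Fin d) :
    Derivation R (MvPowerSeries (Fin d) R) (MvPowerSeries (Fin d) R) :=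
  -- Setting `Y = 0` undoes the comultiplication, so the Leibniz rule for `∂/∂Y_i` becomes the
  -- Leibniz rule on `A` itself.
  have hz : ∀ f, killCompl Function.Embedding.inl (hF.comul f) = f := fun f => by
    have := LinearMap.congr_fun hF.invOp_zero f
    rw [Module.End.one_apply] at this
    conv_rhs => rw [← this]
    ext n
    rw [coeff_killCompl, embDomain_inl, coeff_invOp]
  Derivation.mk' ((killCompl Function.Embedding.inl).toLinearMap ∘ₗ
    (pderiv R (Sum.inr i)).toLinearMap ∘ₗ hF.comul.toLinearMap) fun f g => by
      simp [hz]

theorem der_apply (hF : IsFormalGroupLaw F) (i : Fin d) (f : MvPowerSeries (Fin d) R) :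
    hF.der i f = hF.invOp (single i 1) f := by
  ext n
  rw [coeff_invOp]
  change coeff n (killCompl Function.Embedding.inl (pderiv R (Sum.inr i) (hF.comul f))) = _
  rw [coeff_killCompl, coeff_pderiv, embDomain_inl]
  simp only [← sumElim_zero_single, ← sumElim_add]
  simp

/-- The two sides are derivations that agree on the variables, hence on all polynomials; for a
monomial no continuity argument is needed. -/
theorem der_monomial (hF : IsFormalGroupLaw F) (i : Fin d) (α : Fin d →₀ ℕ) :
    hF.der i (monomial α 1) = ∑ j, pderiv R j (monomial α 1) * hF.der i (X j) := by
  classical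
  let D : Derivation R (MvPowerSeries (Fin d) R) (MvPowerSeries (Fin d) R) :=
    hF.der i - ∑ j, hF.der i (X j) • pderiv R j
  have hDf : ∀ f, D f = hF.der i f - ∑ j, hF.der i (X j) * pderiv R j f := fun f => by
    have := map_sum (Pi.evalAddMonoidHom (fun _ => MvPowerSeries (Fin d) R) f |>.comp
      Derivation.coeFnAddMonoidHom) (fun j => hF.der i (X j) • pderiv R j) Finset.univ
    exact congrArg (hF.der i f - ·) this
  have hD : ∀ k, D (X k) = 0 := fun k => by
    simp only [hDf, pderiv_X]
    rw [Finset.sum_eq_single k] <;> simp +contextual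
  have h : D (monomial α 1) =
      (0 : Derivation R (MvPowerSeries (Fin d) R) (MvPowerSeries (Fin d) R)) (monomial α 1) := by
    refine Derivation.eqOn_adjoin (s := Set.range (X (R := R))) (by rintro _ ⟨k, rfl⟩; simp [hD]) ?_
    rw [← prod_pow_X]
    exact Subalgebra.prod_mem _ fun k _ =>
      Subalgebra.pow_mem _ (Algebra.subset_adjoin (Set.mem_range_self k)) _
  rw [hDf, Derivation.zero_apply] at h
  rw [sub_eq_zero.mp h]
  exact Finset.sum_congr rfl fun j _ => mul_comm _ _

end IsFormalGroupLaw

/-! ### Factorials of multi-indices, and integrality of the rescaled operators. -/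

/-- The factorial `α! = ∏ α_i!` of a multi-index. -/
def multiFactorial {d : ℕ} (α : Fin d →₀ ℕ) : ℕ := ∏ i, (α i).factorial

section multiFactorial

open Finsupp

variable {d : ℕ}

@[simp] theorem multiFactorial_zero : multiFactorial (0 : Fin d →₀ ℕ) = 1 := by
  simp [multiFactorial]

@[simp] theorem multiFactorial_single (i : Fin d) : multiFactorial (single i 1) = 1 := by
  refine Finset.prod_eq_one fun j _ => ?_
  by_cases h : i = j
  · simp [h]
  · simp [Ne.symm h]

theorem multiFactorial_ne_zero (α : Fin d →₀ ℕ) : multiFactorial α ≠ 0 :=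
  Finset.prod_ne_zero_iff.mpr fun _ _ => Nat.factorial_ne_zero _

theorem multiFactorial_dvd {α β : Fin d →₀ ℕ} (h : α ≤ β) :
    multiFactorial α ∣ multiFactorial β :=
  Finset.prod_dvd_prod_of_dvd _ _ fun i _ => Nat.factorial_dvd_factorial (h i)

theorem multiFactorial_add_single (α : Fin d →₀ ℕ) (j : Fin d) :
    multiFactorial (α + single j 1) = (α j + 1) * multiFactorial α := by
  classical
  rw [multiFactorial, multiFactorial, ← Finset.mul_prod_erase _ _ (Finset.mem_univ j),
    ← Finset.mul_prod_erase _ (fun i => (α i).factorial) (Finset.mem_univ j), ← mul_assoc]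
  congr 1
  · simp [Nat.factorial_succ]
  · refine Finset.prod_congr rfl fun i hi => ?_
    simp [(Finset.ne_of_mem_erase hi)]

end multiFactorial

theorem Finsupp.exists_eq_single_of_degree_eq_one {σ : Type*} {α : σ →₀ ℕ} (h : α.degree = 1) :
    ∃ k, α = single k 1 := by
  obtain ⟨k, hk⟩ := Finsupp.ne_iff.mp (show α ≠ 0 by rintro rfl; simp at h)
  have hle : single k 1 ≤ α := by simpa using Nat.one_le_iff_ne_zero.mpr hk
  obtain ⟨κ, rfl⟩ := exists_add_of_le hle
  have : κ = 0 := by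
    rw [← Finsupp.degree_eq_zero_iff]
    rw [map_add, degree_single] at h
    omega
  exact ⟨k, by rw [this, add_zero]⟩

namespace IsFormalGroupLaw

open MvPowerSeries Finsupp

variable {R : Type*} [CommRing R] {d : ℕ} {F : Fin d → MvPowerSeries (Fin d ⊕ Fin d) R}

/-- Write `α = α' + e_j`, so that `∂_j X ^ α = (α'_j + 1) X ^ α'`. Only `α' ≤ β` contributes, and
then `β! (α'_j + 1) = (β! / α'!) α!` with integral quotient. In the top degree `α' = β`, and what
remains is the constant term of `D_i X_j`, which is `1` or `0` according to whether `i = j`. -/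
theorem exists_coeff_pderiv_mul (hF : IsFormalGroupLaw F) (α β : Fin d →₀ ℕ) (i j : Fin d) :
    ∃ c : R, (multiFactorial β : R) * coeff β (pderiv R j (monomial α 1) * hF.der i (X j)) =
        multiFactorial α * c ∧
      (β.degree + 1 < α.degree → c = 0) ∧
      (α.degree = β.degree + 1 → c = if α = β + single i 1 ∧ j = i then 1 else 0) := by
  classical
  by_cases hj : α j = 0
  · refine ⟨0, ?_, fun _ => rfl, fun _ => ?_⟩
    · rw [← MvPolynomial.coe_monomial, pderiv_coe, MvPolynomial.pderiv_monomial, hj]; simp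
    · rw [if_neg]
      rintro ⟨rfl, rfl⟩
      simp at hj
  obtain ⟨α, rfl⟩ : ∃ α', α = α' + single j 1 :=
    ⟨α - single j 1, (tsub_add_cancel_of_le (by simpa using Nat.one_le_iff_ne_zero.mpr hj)).symm⟩
  have hco : coeff β (pderiv R j (monomial (α + single j 1) 1) * hF.der i (X j)) =
      if α ≤ β then ((α j + 1 : ℕ) : R) * coeff (β - α) (hF.der i (X j)) else 0 := by
    rw [← MvPolynomial.coe_monomial, pderiv_coe, MvPolynomial.pderiv_monomial, add_tsub_cancel_right,
      MvPolynomial.coe_monomial, coeff_monomial_mul]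
    simp
  have hdeg : (α + single j 1).degree = α.degree + 1 := by simp
  rw [hco, hdeg]
  by_cases hle : α ≤ β
  · rw [if_pos hle]
    obtain ⟨κ, rfl⟩ := exists_add_of_le hle
    obtain ⟨q, hq⟩ := multiFactorial_dvd hle
    rw [add_tsub_cancel_left, map_add]
    refine ⟨q * coeff κ (hF.der i (X j)), ?_, fun h => by omega, fun h => ?_⟩
    · rw [hq, multiFactorial_add_single]; push_cast; ring
    · have hκ : κ = 0 := by rw [← Finsupp.degree_eq_zero_iff]; omega
      subst hκ
      have hq1 : q = 1 := by
        rw [add_zero] at hq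
        exact Nat.eq_of_mul_eq_mul_left (Nat.pos_of_ne_zero (multiFactorial_ne_zero α)) (by omega)
      rw [hq1, der_apply, coeff_zero_invOp, coeff_X, add_zero]
      by_cases hij : j = i
      · simp [hij]
      · simp [hij, Ne.symm hij, single_left_inj]
  · rw [if_neg hle]
    refine ⟨0, by simp, fun _ => rfl, fun _ => ?_⟩
    rw [if_neg]
    rintro ⟨h, rfl⟩
    exact hle (add_right_cancel h).le

theorem exists_coeff_der_monomial (hF : IsFormalGroupLaw F) (α β : Fin d →₀ ℕ) (i : Fin d) :
    ∃ c : R, (multiFactorial β : R) * coeff β (hF.der i (monomial α 1)) = multiFactorial α * c ∧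
      (β.degree + 1 < α.degree → c = 0) ∧
      (α.degree = β.degree + 1 → c = if α = β + single i 1 then 1 else 0) := by
  classical
  choose c h1 h2 h3 using fun j => hF.exists_coeff_pderiv_mul α β i j
  refine ⟨∑ j, c j, ?_, fun h => Finset.sum_eq_zero fun j _ => h2 j h, fun h => ?_⟩
  · rw [der_monomial, map_sum, Finset.mul_sum, Finset.mul_sum]
    exact Finset.sum_congr rfl fun j _ => h1 j
  · rw [Finset.sum_congr rfl fun j _ => h3 j h]
    by_cases hα : α = β + single i 1 <;> simp [hα]

/-- The multiple `γ! • invOp γ`, which lies in the algebra generated by the invariant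
derivations. -/
noncomputable def powOp (hF : IsFormalGroupLaw F) (γ : Fin d →₀ ℕ) :
    Module.End R (MvPowerSeries (Fin d) R) :=
  (multiFactorial γ : R) • hF.invOp γ

theorem powOp_zero (hF : IsFormalGroupLaw F) : hF.powOp 0 = 1 := by
  simp [powOp, invOp_zero]

theorem powOp_single (hF : IsFormalGroupLaw F) (i : Fin d) :
    hF.powOp (single i 1) = hF.invOp (single i 1) := by
  simp [powOp]

theorem coeff_zero_powOp_monomial (hF : IsFormalGroupLaw F) (α β : Fin d →₀ ℕ)
    [Decidable (α = β)] :
    coeff 0 (hF.powOp α (monomial β 1)) = if α = β then (multiFactorial α : R) else 0 := by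
  classical
  rw [powOp, LinearMap.smul_apply, map_smul, coeff_zero_invOp, coeff_monomial]
  simp

theorem linearIndependent_powOp [IsDomain R] [CharZero R] (hF : IsFormalGroupLaw F) :
    LinearIndependent R hF.powOp := by
  classical
  rw [linearIndependent_iff']
  intro s g hg β hβ
  have h := congrArg (fun T : Module.End R (MvPowerSeries (Fin d) R) =>
    coeff 0 (T (monomial β 1))) hg
  simp only [LinearMap.sum_apply, LinearMap.smul_apply, map_sum, map_smul,
    coeff_zero_powOp_monomial, LinearMap.zero_apply, map_zero] at h
  rw [Finset.sum_eq_single β (by simp +contextual) (by simp [hβ])] at h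
  simpa [multiFactorial_ne_zero] using h

/-- After rescaling by factorials the structure constants stay in `R`, no index has degree above
`|β| + 1`, and in that degree only `β + e_i` occurs, with coefficient `1`: the triangularity of
ordered monomials in an enveloping algebra. -/
theorem powOp_mul_sub_mem (hF : IsFormalGroupLaw F) (β : Fin d →₀ ℕ) (i : Fin d) :
    hF.powOp β * hF.invOp (single i 1) - hF.powOp (β + single i 1) ∈
      Submodule.span R (hF.powOp '' {α | α.degree ≤ β.degree}) := by
  classical
  choose c h1 h2 h3 using fun α => hF.exists_coeff_der_monomial α β i
  set s := (hF.finite_structure β (single i 1)).toFinset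
  have hmul : hF.powOp β * hF.invOp (single i 1) =
      ∑ α ∈ insert (β + single i 1) s, c α • hF.powOp α := by
    rw [powOp, smul_mul_assoc, invOp_mul_invOp,
      Finset.sum_subset (Finset.subset_insert (β + single i 1) s), Finset.smul_sum]
    · refine Finset.sum_congr rfl fun α _ => ?_
      rw [powOp, smul_smul, smul_smul, mul_comm (c α), ← h1 α, der_apply]
    · intro α _ hα
      have : coeff β (hF.invOp (single i 1) (monomial α 1)) = 0 := by simpa [s] using hα
      rw [this, zero_smul]
  rw [hmul, ← Finset.add_sum_erase _ _ (Finset.mem_insert_self _ _), h3 _ (by simp), if_pos rfl,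
    one_smul, add_sub_cancel_left]
  refine Submodule.sum_mem _ fun α hα => ?_
  have hne := Finset.ne_of_mem_erase hα
  rcases lt_trichotomy α.degree (β.degree + 1) with h | h | h
  · exact Submodule.smul_mem _ _ (Submodule.subset_span ⟨α, Nat.lt_succ_iff.mp h, rfl⟩)
  · rw [h3 α h, if_neg hne, zero_smul]; exact Submodule.zero_mem _
  · rw [h2 α h, zero_smul]; exact Submodule.zero_mem _

/-- Both products have the leading term attached to `e_i + e_j`, so it cancels and degree at most
one is left. -/
theorem invOp_commutator_mem (hF : IsFormalGroupLaw F) (i j : Fin d) :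
    hF.invOp (single i 1) * hF.invOp (single j 1) - hF.invOp (single j 1) * hF.invOp (single i 1) ∈
      Submodule.span R (Set.range fun k : Fin d => hF.invOp (single k 1)) := by
  classical
  have h1 := hF.powOp_mul_sub_mem (single i 1) j
  have h2 := hF.powOp_mul_sub_mem (single j 1) i
  have hle : Submodule.span R (hF.powOp '' {α | α.degree ≤ 1}) ≤
      Submodule.span R {1} ⊔
        Submodule.span R (Set.range fun k : Fin d => hF.invOp (single k 1)) := by
    rw [Submodule.span_le]
    rintro _ ⟨α, hα, rfl⟩
    rcases Nat.le_one_iff_eq_zero_or_eq_one.mp hα with h | h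
    · rw [Finsupp.degree_eq_zero_iff] at h
      rw [h, powOp_zero]
      exact Submodule.mem_sup_left (Submodule.mem_span_singleton_self _)
    · obtain ⟨k, rfl⟩ := exists_eq_single_of_degree_eq_one h
      rw [powOp_single]
      exact Submodule.mem_sup_right (Submodule.subset_span ⟨k, rfl⟩)
  rw [powOp_single, degree_single] at h1 h2
  rw [add_comm (single j 1)] at h2
  have h := hle (Submodule.sub_mem _ h1 h2)
  rw [sub_sub_sub_cancel_right] at h
  obtain ⟨y, hy, z, hz, hyz⟩ := Submodule.mem_sup.mp h
  obtain ⟨r, rfl⟩ := Submodule.mem_span_singleton.mp hy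
  -- Derivations kill the constant `1`, so applying the relation to `1` shows that the multiple `r`
  -- of the identity is zero.
  have hone : ∀ k, hF.invOp (single k 1) 1 = 0 := fun k => by
    rw [← der_apply]; exact Derivation.map_one_eq_zero _
  have hz1 : z 1 = 0 := by
    have : Submodule.span R (Set.range fun k : Fin d => hF.invOp (single k 1)) ≤
        LinearMap.ker (LinearMap.applyₗ (R := R) (M₂ := MvPowerSeries (Fin d) R)
          (1 : MvPowerSeries (Fin d) R)) := by
      rw [Submodule.span_le]
      rintro _ ⟨k, rfl⟩
      exact hone k
    exact this hz
  have hr : r = 0 := by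
    have := congrArg (fun T : Module.End R (MvPowerSeries (Fin d) R) => coeff 0 (T 1)) hyz
    simpa [hz1, hone] using this
  rw [← hyz, hr, zero_smul, zero_add]
  exact hz

end IsFormalGroupLaw

/-! ### A Poincaré–Birkhoff–Witt argument for words in a Lie algebra. -/

namespace OrderedMonomial

open Finsupp

variable {R B D : Type*} [CommRing R] [Ring B] [Algebra R B] [Ring D] [Algebra R D] {d : ℕ}

/-- The multi-index counting the letters of a word. -/
noncomputable def content (l : List (Fin d)) : Fin d →₀ ℕ := (l.map fun i => single i 1).sum

theorem content_concat (l : List (Fin d)) (i : Fin d) :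
    content (l ++ [i]) = content l + single i 1 := by simp [content]

theorem content_apply (l : List (Fin d)) (i : Fin d) : content l i = l.count i := by
  classical
  induction l with
  | nil => simp [content]
  | cons a l ih =>
    have : content (a :: l) = single a 1 + content l := by simp [content]
    rw [this, Finsupp.add_apply, ih, List.count_cons, single_apply, add_comm]
    simp

theorem degree_content (l : List (Fin d)) : (content l).degree = l.length := by
  induction l with
  | nil => simp [content]
  | cons a l ih =>
    have : content (a :: l) = single a 1 + content l := by simp [content]
    rw [this, map_add, ih, degree_single, List.length_cons, add_comm]

theorem exists_content_eq (α : Fin d →₀ ℕ) : ∃ l : List (Fin d), content l = α := by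
  induction α using Finsupp.induction_linear with
  | zero => exact ⟨[], rfl⟩
  | add f g hf hg =>
    obtain ⟨l, rfl⟩ := hf
    obtain ⟨l', rfl⟩ := hg
    exact ⟨l ++ l', by simp [content]⟩
  | single i n =>
    exact ⟨List.replicate n i, by simp [content, List.map_replicate]⟩

theorem perm_of_content_eq {l l' : List (Fin d)} (h : content l = content l') : l.Perm l' := by
  classical
  exact List.perm_iff_count.mpr fun i => by rw [← content_apply, h, content_apply]

/-- The span of the products of fewer than `n` of the elements `t i`. -/
def wordSpan (R : Type*) [CommRing R] [Algebra R D] (t : Fin d → D) (n : ℕ) : Submodule R D :=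
  Submodule.span R ((fun l : List (Fin d) => (l.map t).prod) '' {l | l.length < n})

theorem prod_mem_wordSpan (t : Fin d → D) {n : ℕ} {l : List (Fin d)} (h : l.length < n) :
    (l.map t).prod ∈ wordSpan R t n := Submodule.subset_span ⟨l, h, rfl⟩

theorem wordSpan_mono (t : Fin d → D) {m n : ℕ} (h : m ≤ n) :
    wordSpan R t m ≤ wordSpan R t n :=
  Submodule.span_mono (Set.image_mono fun _ hl => lt_of_lt_of_le hl h)

theorem mul_mem_wordSpan (t : Fin d → D) (i : Fin d) {n : ℕ} {x : D} (hx : x ∈ wordSpan R t n) :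
    t i * x ∈ wordSpan R t (n + 1) := by
  have : wordSpan R t n ≤ (wordSpan R t (n + 1)).comap (LinearMap.mulLeft R (t i)) := by
    refine Submodule.span_le.mpr ?_
    rintro _ ⟨l, hl, rfl⟩
    have := prod_mem_wordSpan (R := R) t (n := n + 1) (l := i :: l) (by simpa using hl)
    simpa using this
  exact this hx

/-- Swapping two neighbouring letters costs their commutator, a combination of single letters, hence
only words shorter by one. -/
theorem prod_sub_prod_mem (t : Fin d → D)
    (hcomm : ∀ i j, t i * t j - t j * t i ∈ Submodule.span R (Set.range t))
    {l l' : List (Fin d)} (h : l.Perm l') :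
    (l.map t).prod - (l'.map t).prod ∈ wordSpan R t l.length := by
  induction h with
  | nil => simp
  | cons a _ ih =>
    simp only [List.map_cons, List.prod_cons, ← mul_sub, List.length_cons]
    exact mul_mem_wordSpan t a ih
  | swap i j l =>
    have h : Submodule.span R (Set.range t) ≤
        (wordSpan R t (l.length + 2)).comap (LinearMap.mulRight R (l.map t).prod) := by
      refine Submodule.span_le.mpr ?_
      rintro _ ⟨k, rfl⟩
      have := prod_mem_wordSpan (R := R) t (n := l.length + 2) (l := k :: l) (by simp)
      simpa using this
    have := h (hcomm j i)
    simpa [sub_mul, mul_assoc] using this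
  | trans h₁ _ ih₁ ih₂ =>
    rw [← sub_add_sub_cancel]
    exact Submodule.add_mem _ ih₁ (h₁.length_eq ▸ ih₂)

variable {v : (Fin d →₀ ℕ) → B} {π : D →ₐ[R] B} {t : Fin d → D}

theorem map_prod_sub_mem (h0 : v 0 = 1)
    (hmul : ∀ β i, v β * v (single i 1) - v (β + single i 1) ∈
      Submodule.span R (v '' {α | α.degree ≤ β.degree}))
    (hπ : ∀ i, π (t i) = v (single i 1)) (l : List (Fin d)) :
    π (l.map t).prod - v (content l) ∈ Submodule.span R (v '' {α | α.degree < l.length}) := by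
  -- Letters are appended at the end because `hmul` describes multiplication on the right.
  induction l using List.reverseRecOn with
  | nil => simp [content, h0]
  | append_singleton l i ih =>
    have hlt : Submodule.span R (v '' {α | α.degree < l.length}) ≤
        (Submodule.span R (v '' {α | α.degree < (l ++ [i]).length})).comap
          (LinearMap.mulRight R (v (single i 1))) := by
      refine Submodule.span_le.mpr ?_
      rintro _ ⟨α, hα, rfl⟩
      rw [SetLike.mem_coe, Submodule.mem_comap, LinearMap.mulRight_apply]
      rw [← sub_add_cancel (v α * v (single i 1)) (v (α + single i 1))]
      have hα' : α.degree < l.length := hα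
      refine Submodule.add_mem _ (Submodule.span_mono (Set.image_mono fun κ hκ => ?_) (hmul α i))
        (Submodule.subset_span ⟨_, ?_, rfl⟩)
      · have : κ.degree ≤ α.degree := hκ
        change κ.degree < (l ++ [i]).length
        simp only [List.length_append, List.length_singleton]
        omega
      · change (α + single i 1).degree < _
        rw [map_add, degree_single]
        simpa using hα'
    have h1 := Submodule.mem_comap.mp (hlt ih)
    have h2 : v (content l) * v (single i 1) - v (content l + single i 1) ∈
        Submodule.span R (v '' {α | α.degree < (l ++ [i]).length}) := by
      refine Submodule.span_mono (Set.image_mono fun κ hκ => ?_) (hmul (content l) i)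
      have : κ.degree ≤ (content l).degree := hκ
      rw [degree_content] at this
      change κ.degree < (l ++ [i]).length
      simp only [List.length_append, List.length_singleton]
      omega
    rw [content_concat]
    have := Submodule.add_mem _ h1 h2
    simpa [LinearMap.mulRight_apply, sub_mul, hπ] using this

theorem map_mem_of_mem_wordSpan (h0 : v 0 = 1)
    (hmul : ∀ β i, v β * v (single i 1) - v (β + single i 1) ∈
      Submodule.span R (v '' {α | α.degree ≤ β.degree}))
    (hπ : ∀ i, π (t i) = v (single i 1)) {n : ℕ} {x : D} (hx : x ∈ wordSpan R t n) :
    π x ∈ Submodule.span R (v '' {α | α.degree < n}) := by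
  have : wordSpan R t n ≤ (Submodule.span R (v '' {α | α.degree < n})).comap π.toLinearMap := by
    refine Submodule.span_le.mpr ?_
    rintro _ ⟨l, hl, rfl⟩
    rw [SetLike.mem_coe, Submodule.mem_comap, AlgHom.toLinearMap_apply]
    rw [← sub_add_cancel (π (l.map t).prod) (v (content l))]
    have hl' : l.length < n := hl
    refine Submodule.add_mem _ (Submodule.span_mono (Set.image_mono fun κ hκ => ?_)
      (map_prod_sub_mem h0 hmul hπ l)) (Submodule.subset_span ⟨_, ?_, rfl⟩)
    · exact lt_trans hκ hl'
    · change (content l).degree < n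
      rwa [degree_content]
  exact this hx

/-- Modulo shorter words every word of length `n` equals a chosen word `L α` with the same letters,
and `π` sends that word to `v α` plus lower degree. Independence of `v` kills the coefficients in
degree `n`, and induction handles the rest. -/
theorem eq_zero_of_map_eq_zero (hv : LinearIndependent R v) (h0 : v 0 = 1)
    (hmul : ∀ β i, v β * v (single i 1) - v (β + single i 1) ∈
      Submodule.span R (v '' {α | α.degree ≤ β.degree}))
    (hπ : ∀ i, π (t i) = v (single i 1))
    (hcomm : ∀ i j, t i * t j - t j * t i ∈ Submodule.span R (Set.range t)) (n : ℕ) {x : D}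
    (hx : x ∈ wordSpan R t n) (hx0 : π x = 0) : x = 0 := by
  induction n generalizing x with
  | zero => simpa [wordSpan] using hx
  | succ n ih =>
    choose L hL using exists_content_eq (d := d)
    have hle : wordSpan R t (n + 1) ≤
        Submodule.span R ((fun α => ((L α).map t).prod) '' {α | α.degree = n}) ⊔
          wordSpan R t n := by
      refine Submodule.span_le.mpr ?_
      rintro _ ⟨l, hl, rfl⟩
      rcases (Nat.lt_succ_iff.mp hl).lt_or_eq with h | h
      · exact Submodule.mem_sup_right (prod_mem_wordSpan t h)
      · have hp := prod_sub_prod_mem t hcomm (perm_of_content_eq (hL (content l)).symm)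
        rw [h] at hp
        change (l.map t).prod ∈ _
        rw [← sub_add_cancel (l.map t).prod (((L (content l)).map t).prod), add_comm]
        exact Submodule.add_mem_sup
          (Submodule.subset_span ⟨content l, by simp [degree_content, h], rfl⟩) hp
    obtain ⟨y, hy, z, hz, rfl⟩ := Submodule.mem_sup.mp (hle hx)
    obtain ⟨a, ha, rfl⟩ := (Finsupp.mem_span_image_iff_linearCombination R).mp hy
    have hlow : π (linearCombination R (fun α => ((L α).map t).prod) a) -
        linearCombination R v a ∈ Submodule.span R (v '' {α | α.degree < n}) := by
      rw [linearCombination_apply, linearCombination_apply, Finsupp.sum, Finsupp.sum, map_sum,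
        ← Finset.sum_sub_distrib]
      refine Submodule.sum_mem _ fun α hα => ?_
      rw [map_smul, ← smul_sub]
      have hdeg : α.degree = n := ha hα
      have := map_prod_sub_mem h0 hmul hπ (L α)
      rw [hL, ← degree_content, hL, hdeg] at this
      exact Submodule.smul_mem _ _ this
    have hz' := map_mem_of_mem_wordSpan h0 hmul hπ hz
    have hmem : linearCombination R v a ∈ Submodule.span R (v '' {α | α.degree < n}) := by
      have := Submodule.neg_mem _ (Submodule.add_mem _ hlow hz')
      rw [map_add] at hx0
      rw [sub_add_eq_add_sub, hx0, zero_sub, neg_neg] at this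
      exact this
    have hmem' : linearCombination R v a ∈ Submodule.span R (v '' {α | α.degree = n}) :=
      (Finsupp.mem_span_image_iff_linearCombination R).mpr ⟨a, ha, rfl⟩
    have hdis : Disjoint {α : Fin d →₀ ℕ | α.degree = n} {α | α.degree < n} :=
      Set.disjoint_left.mpr fun α h h' => (ne_of_lt h') h
    have ha0 : a = 0 := by
      refine (linearIndependent_iff.mp hv) a ?_
      exact Submodule.disjoint_def.mp (hv.disjoint_span_image hdis) _ hmem' hmem
    subst ha0
    simp only [map_zero, zero_add] at hx0 ⊢
    exact ih hz hx0

/-- If `v` behaves like the family of ordered monomials of an enveloping algebra, and the elements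
`t i` lift the `v (single i 1)` and span a Lie algebra, then `v` lifts multiplicatively. -/
theorem exists_lift (hv : LinearIndependent R v) (h0 : v 0 = 1)
    (hmul : ∀ β i, v β * v (single i 1) - v (β + single i 1) ∈
      Submodule.span R (v '' {α | α.degree ≤ β.degree}))
    (hπ : ∀ i, π (t i) = v (single i 1))
    (hcomm : ∀ i j, t i * t j - t j * t i ∈ Submodule.span R (Set.range t)) :
    ∃ τ : (Fin d →₀ ℕ) → D, τ 0 = 1 ∧ (∀ i, τ (single i 1) = t i) ∧ (∀ α, π (τ α) = v α) ∧
      ∀ β γ, ∃ e : (Fin d →₀ ℕ) →₀ R, τ β * τ γ = e.sum fun α r => r • τ α := by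
  let T : Submodule R D := Submodule.span R (Set.range fun l : List (Fin d) => (l.map t).prod)
  have hTn : ∀ x ∈ T, ∃ n, x ∈ wordSpan R t n := fun x hx => by
    induction hx using Submodule.span_induction with
    | mem _ h =>
      obtain ⟨l, rfl⟩ := h
      exact ⟨l.length + 1, prod_mem_wordSpan t (Nat.lt_succ_self _)⟩
    | zero => exact ⟨0, Submodule.zero_mem _⟩
    | add _ _ _ _ h₁ h₂ =>
      obtain ⟨m, hm⟩ := h₁
      obtain ⟨n, hn⟩ := h₂
      exact ⟨max m n, Submodule.add_mem _ (wordSpan_mono t (le_max_left _ _) hm)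
        (wordSpan_mono t (le_max_right _ _) hn)⟩
    | smul r _ _ h =>
      obtain ⟨n, hn⟩ := h
      exact ⟨n, Submodule.smul_mem _ _ hn⟩
  -- Since `π` is injective on the span of all words, identities between elements of `T` may be
  -- checked after `π`.
  have hinj : ∀ x ∈ T, ∀ y ∈ T, π x = π y → x = y := fun x hx y hy h => by
    obtain ⟨n, hn⟩ := hTn _ (Submodule.sub_mem _ hx hy)
    exact sub_eq_zero.mp
      (eq_zero_of_map_eq_zero hv h0 hmul hπ hcomm n hn (by rw [map_sub, h, sub_self]))
  have hTmul : ∀ x ∈ T, ∀ y ∈ T, x * y ∈ T := fun x hx y hy => by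
    have h : T * T ≤ T := by
      rw [Submodule.span_mul_span]
      refine Submodule.span_mono ?_
      rintro _ ⟨_, ⟨l, rfl⟩, _, ⟨l', rfl⟩, rfl⟩
      exact ⟨l ++ l', by simp⟩
    exact h (Submodule.mul_mem_mul hx hy)
  have hlift : ∀ n, ∀ α : Fin d →₀ ℕ, α.degree = n → ∃ τ ∈ T, π τ = v α := fun n => by
    induction n using Nat.strong_induction_on with
    | _ n ih =>
      rintro α rfl
      obtain ⟨l, rfl⟩ := exists_content_eq α
      have hle : Submodule.span R (v '' {α | α.degree < l.length}) ≤ T.map π.toLinearMap := by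
        refine Submodule.span_le.mpr ?_
        rintro _ ⟨κ, hκ, rfl⟩
        exact ih κ.degree (by rw [degree_content]; exact hκ) κ rfl
      obtain ⟨y, hy, hy'⟩ := hle (map_prod_sub_mem h0 hmul hπ l)
      refine ⟨(l.map t).prod - y, Submodule.sub_mem _ (Submodule.subset_span ⟨l, rfl⟩) hy, ?_⟩
      rw [map_sub, show π y = _ from hy', sub_sub_cancel]
  choose τ hτ hτv using fun α => hlift _ α rfl
  refine ⟨τ, ?_, fun i => ?_, hτv, fun β γ => ?_⟩
  · refine hinj _ (hτ 0) _ (Submodule.subset_span ⟨[], by simp⟩) ?_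
    rw [hτv, h0, map_one]
  · refine hinj _ (hτ _) _ (Submodule.subset_span ⟨[i], by simp⟩) ?_
    rw [hτv, hπ]
  · have hmem := hTmul _ (hτ β) _ (hτ γ)
    obtain ⟨n, hn⟩ := hTn _ hmem
    obtain ⟨e, -, he⟩ := (Finsupp.mem_span_image_iff_linearCombination R).mp
      (map_mem_of_mem_wordSpan h0 hmul hπ hn)
    refine ⟨e, hinj _ hmem _ (Submodule.sum_mem _ fun α _ => Submodule.smul_mem _ _ (hτ α)) ?_⟩
    rw [← he, linearCombination_apply, Finsupp.sum, Finsupp.sum, map_sum]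
    simp [hτv]

end OrderedMonomial

/-! ### Closed submodules and sums; the topology of a Noetherian local pro-`p` ring. -/

theorem HasSum.mem_of_isClosed {ι M S : Type*} [AddCommMonoid M] [TopologicalSpace M] [SetLike S M]
    [AddSubmonoidClass S M] {s : S} (hs : IsClosed (s : Set M)) {f : ι → M} {a : M}
    (hf : HasSum f a) (h : ∀ i, f i ∈ s) : a ∈ s :=
  hs.mem_of_tendsto hf <| .of_forall fun _ => sum_mem fun i _ => h i

theorem HasSum.sub_mem_of_isClosed {ι M S : Type*} [AddCommGroup M] [TopologicalSpace M]
    [IsTopologicalAddGroup M] [SetLike S M] [AddSubmonoidClass S M] {s : S}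
    (hs : IsClosed (s : Set M)) {f : ι → M} {a : M} (hf : HasSum f a) (i : ι)
    (h : ∀ j, j ≠ i → f j ∈ s) : a - f i ∈ s := by
  classical
  refine (hasSum_ite_sub_hasSum hf i).mem_of_isClosed hs fun j => ?_
  split_ifs with hj
  · exact zero_mem s
  · exact h j hj

namespace IsProPRing

open IsLocalRing

variable {p : ℕ} {R : Type*} [CommRing R] [IsNoetherianRing R] [IsLocalRing R]
  [TopologicalSpace R] [IsTopologicalRing R]

/-- The quotient by an open ideal is finite, hence Artinian, so its maximal ideal is nilpotent. With
`isOpen_pow` this identifies the topology as the `𝔪`-adic one. -/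
theorem exists_pow_le (hR : IsProPRing p R) (hp : p.Prime) {U : Set R} (hU : U ∈ 𝓝 (0 : R)) :
    ∃ k : ℕ, ((maximalIdeal R ^ k : Ideal R) : Set R) ⊆ U := by
  obtain ⟨I, hI, hIU, n, hn⟩ := hR.exists_ideal U hU
  have : Finite (R ⧸ I) := Nat.finite_of_card_ne_zero (by rw [hn]; exact pow_ne_zero _ hp.ne_zero)
  obtain ⟨k, hk⟩ := exists_maximalIdeal_pow_le_of_isArtinianRing_quotient I
  exact ⟨k, Set.Subset.trans (show maximalIdeal R ^ k ≤ I from hk) hIU⟩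

theorem isOpen_pow (hR : IsProPRing p R) (k : ℕ) :
    IsOpen ((maximalIdeal R ^ k : Ideal R) : Set R) :=
  have := hR.compactSpace
  have := hR.t2Space
  isOpen_maximalIdeal_pow R k

theorem isClosed_ideal (hR : IsProPRing p R) (I : Ideal R) : IsClosed (I : Set R) :=
  have := hR.compactSpace
  have := hR.t2Space
  IsNoetherianRing.isClosed_ideal I

theorem natCast_mem (hR : IsProPRing p R) : (p : R) ∈ maximalIdeal R := by
  have := hR.t2Space
  obtain ⟨I, -, hI, n, hn⟩ := hR.exists_ideal {(1 : R)}ᶜ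
    (isOpen_compl_singleton.mem_nhds (by simp))
  have hIm : I ≤ maximalIdeal R := le_maximalIdeal fun h => hI (by rw [h]; trivial) rfl
  have h1 : ((p : R ⧸ I)) ^ n = 0 := by
    have := card_nsmul_eq_zero' (G := R ⧸ I) (x := 1)
    rw [hn] at this
    simpa using this
  have h2 : (p : R) ^ n ∈ I := by
    rw [← Ideal.Quotient.eq_zero_iff_mem]
    simpa using h1
  exact Ideal.IsPrime.mem_of_pow_mem inferInstance n (hIm h2)

theorem eq_zero_of_forall_mem_pow {x : R} (h : ∀ k, x ∈ maximalIdeal R ^ k) : x = 0 := by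
  have := Ideal.iInf_pow_eq_bot_of_isLocalRing (maximalIdeal R) (Ideal.IsPrime.ne_top inferInstance)
  rw [← Ideal.mem_bot, ← this]
  simpa using h

theorem eq_zero_of_forall_dvd (hR : IsProPRing p R) {x : R} (h : ∀ k, (p : R) ^ k ∣ x) :
    x = 0 :=
  eq_zero_of_forall_mem_pow fun k =>
    Ideal.mem_of_dvd _ (h k) (Ideal.pow_mem_pow hR.natCast_mem k)

theorem isLinearTopology (hR : IsProPRing p R) : IsLinearTopology R R :=
  IsLinearTopology.mk_of_hasBasis' R (S := Ideal R) (p := fun I : Ideal R => IsOpen (I : Set R))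
    (s := id)
    ⟨fun U => ⟨fun hU => by
      obtain ⟨I, hI, hIU, -⟩ := hR.exists_ideal U hU
      exact ⟨I, hI, hIU⟩, fun ⟨I, hI, hIU⟩ =>
        Filter.mem_of_superset (hI.mem_nhds I.zero_mem) hIU⟩⟩
    fun I r _ hm => I.mul_mem_left r hm

theorem hasEval (hR : IsProPRing p R) (hp : p.Prime) {σ : Type*} [Finite σ] {a : σ → R}
    (ha : ∀ i, a i ∈ maximalIdeal R) : MvPowerSeries.HasEval a where
  hpow i := by
    refine Filter.tendsto_def.mpr fun U hU => ?_
    obtain ⟨k, hk⟩ := hR.exists_pow_le hp hU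
    exact Filter.mem_atTop_sets.mpr ⟨k, fun n hn =>
      hk (Ideal.pow_le_pow_right hn (Ideal.pow_mem_pow (ha i) n))⟩
  tendsto_zero := by simp [Filter.cofinite_eq_bot]

theorem exists_eval (hR : IsProPRing p R) (hp : p.Prime) {σ : Type*} [Finite σ] {a : σ → R}
    (ha : ∀ i, a i ∈ maximalIdeal R) :
    ∃ e : MvPowerSeries σ R →ₐ[R] R, ∀ f, HasValueAt f a (e f) := by
  let _ : UniformSpace R := IsTopologicalAddGroup.rightUniformSpace R
  have : IsUniformAddGroup R := isUniformAddGroup_of_addCommGroup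
  have := hR.compactSpace
  have := hR.t2Space
  have := hR.isLinearTopology
  exact ⟨MvPowerSeries.aeval (hR.hasEval hp ha), fun f => MvPowerSeries.hasSum_aeval _ f⟩

end IsProPRing

/-! ### Evaluating a composite of power series. -/

open MvPowerSeries.WithPiTopology in
-- Coefficients and values live in separate rings so that the coefficient ring can carry the
-- discrete topology, for which formal substitution is compatible with evaluation, while the values
-- keep their own. The application takes both rings equal to `R`.
theorem MvPowerSeries.hasSum_subst {R T : Type*} [CommRing R] [CommRing T] [Algebra R T]
    [UniformSpace T] [IsUniformAddGroup T] [IsTopologicalRing T] [IsLinearTopology T T]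
    [CompleteSpace T] [T2Space T] {σ τ : Type*} {a : σ → MvPowerSeries τ R} (ha : HasSubst a)
    {b : τ → T} (hb : HasEval b) {c : σ → T}
    (hc : ∀ i, HasSum (fun n : τ →₀ ℕ => algebraMap R T (coeff n (a i)) *
      n.prod fun s e => b s ^ e) (c i))
    (f : MvPowerSeries σ R) {r : T}
    (hr : HasSum (fun n : σ →₀ ℕ => algebraMap R T (coeff n f) * n.prod fun s e => c s ^ e) r) :
    HasSum (fun n : τ →₀ ℕ => algebraMap R T (coeff n (subst a f)) *
      n.prod fun s e => b s ^ e) r := by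
  let _ : UniformSpace R := ⊥
  have : DiscreteTopology R := ⟨rfl⟩
  have hφ : Continuous (algebraMap R T) := continuous_of_discreteTopology
  have hc' : (fun s => eval₂ (algebraMap R T) b (a s)) = c :=
    funext fun i => (hasSum_eval₂ hφ hb (a i)).unique (hc i)
  have hcE : HasEval c := by
    have hε : Continuous (eval₂Hom hφ hb) := by
      rw [coe_eval₂Hom]; exact continuous_eval₂ hφ hb
    have := ha.hasEval.map hε
    rwa [coe_eval₂Hom, hc'] at this
  have h := hasSum_eval₂ hφ hb (subst a f)
  rw [eval₂_subst ha hb f, hc'] at h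
  rwa [hr.unique (hasSum_eval₂ hφ hcE f)]

theorem HasValueAt.subst {p : ℕ} {R : Type*} [CommRing R] [IsNoetherianRing R] [IsLocalRing R]
    [TopologicalSpace R] [IsTopologicalRing R] (hR : IsProPRing p R) (hp : p.Prime)
    {σ τ : Type*} [Finite τ] {a : σ → MvPowerSeries τ R} (ha : MvPowerSeries.HasSubst a)
    {b : τ → R} (hb : ∀ i, b i ∈ IsLocalRing.maximalIdeal R) {c : σ → R}
    (hc : ∀ i, HasValueAt (a i) b (c i)) {f : MvPowerSeries σ R} {r : R}
    (hr : HasValueAt f c r) : HasValueAt (MvPowerSeries.subst a f) b r := by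
  let _ : UniformSpace R := IsTopologicalAddGroup.rightUniformSpace R
  have : IsUniformAddGroup R := isUniformAddGroup_of_addCommGroup
  have := hR.compactSpace
  have := hR.t2Space
  have := hR.isLinearTopology
  exact MvPowerSeries.hasSum_subst ha (hR.hasEval hp hb) hc f hr

/-! ### Functions on a standard group; the invariant derivations belong to `L(G)`. -/

namespace StandardGroup

open MvPowerSeries Finsupp IsLocalRing

variable {p : ℕ} {R : Type*} [CommRing R] [IsNoetherianRing R] [IsLocalRing R]
  [TopologicalSpace R] [IsTopologicalRing R] {d : ℕ} {G : Type*} [Group G] [TopologicalSpace G]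

/-- The coordinates of a point, as elements of `R`. -/
def coord (S : StandardGroup R d G) (x : G) (i : Fin d) : R := S.chart x i

theorem coord_mem (S : StandardGroup R d G) (x : G) (i : Fin d) :
    S.coord x i ∈ maximalIdeal R := (S.chart x i).2

@[simp] theorem coord_one (S : StandardGroup R d G) (i : Fin d) : S.coord 1 i = 0 := by
  simp [coord, S.chart_one]

theorem coord_injective (S : StandardGroup R d G) : Function.Injective S.coord := fun _ _ h =>
  S.chart.injective (funext fun i => Subtype.ext (congrFun h i))

theorem exists_coord_eq (S : StandardGroup R d G) {a : Fin d → R}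
    (ha : ∀ i, a i ∈ maximalIdeal R) : ∃ x, S.coord x = a :=
  ⟨S.chart.symm fun i => ⟨a i, ha i⟩, funext fun i => by simp [coord]⟩

theorem continuous_coord (S : StandardGroup R d G) (i : Fin d) :
    Continuous fun x => S.coord x i :=
  continuous_subtype_val.comp ((continuous_apply i).comp S.chart.continuous)

theorem hasValueAt_mul (S : StandardGroup R d G) (x y : G) (i : Fin d) :
    HasValueAt (S.law i) (Sum.elim (S.coord x) (S.coord y)) (S.coord (x * y) i) :=
  S.chart_mul x y i

theorem exists_hasValue (S : StandardGroup R d G) (hR : IsProPRing p R) (hp : p.Prime)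
    (f : MvPowerSeries (Fin d) R) (y : G) : ∃ r, S.HasValue f y r := by
  obtain ⟨e, he⟩ := hR.exists_eval hp (S.coord_mem y)
  exact ⟨e f, he f⟩

theorem hasValueAt_comul (S : StandardGroup R d G) (hR : IsProPRing p R) (hp : p.Prime)
    {f : MvPowerSeries (Fin d) R} {x y : G} {r : R} (h : S.HasValue f (x * y) r) :
    HasValueAt (S.isFormalGroupLaw.comul f) (Sum.elim (S.coord x) (S.coord y)) r := by
  rw [IsFormalGroupLaw.comul, coe_substAlgHom]
  refine HasValueAt.subst hR hp S.isFormalGroupLaw.hasSubst ?_ (S.hasValueAt_mul x y) h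
  rintro (i | i)
  · exact S.coord_mem x i
  · exact S.coord_mem y i

theorem hasSum_prod_comul (S : StandardGroup R d G) (hR : IsProPRing p R) (hp : p.Prime)
    {f : MvPowerSeries (Fin d) R} {x y : G} {r : R} (h : S.HasValue f (x * y) r) :
    HasSum (fun q : (Fin d →₀ ℕ) × (Fin d →₀ ℕ) =>
      coeff q.1 (S.isFormalGroupLaw.invOp q.2 f) *
        ((q.1.prod fun i e => S.coord x i ^ e) * q.2.prod fun i e => S.coord y i ^ e)) r := by
  have h := S.hasValueAt_comul hR hp h
  rw [HasValueAt, ← sumFinsuppEquivProdFinsupp.symm.hasSum_iff] at h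
  convert h using 1
  funext q
  obtain ⟨β, γ⟩ := q
  change _ = coeff (β.sumElim γ) _ * (β.sumElim γ).prod _
  rw [prod_sumElim]
  rfl

theorem hasSum_invOp (S : StandardGroup R d G) (hR : IsProPRing p R) (hp : p.Prime)
    {f : MvPowerSeries (Fin d) R} {x y : G} {r : R} (h : S.HasValue f (x * y) r)
    {A : (Fin d →₀ ℕ) → R} (hA : ∀ γ, S.HasValue (S.isFormalGroupLaw.invOp γ f) x (A γ)) :
    HasSum (fun γ => A γ * γ.prod fun i e => S.coord y i ^ e) r := by
  have h := (Equiv.prodComm _ _).hasSum_iff.mpr (S.hasSum_prod_comul hR hp h)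
  refine h.prod_fiberwise fun γ => ?_
  have h1 := HasSum.mul_right (γ.prod fun i e => S.coord y i ^ e) (hA γ)
  simp only [mul_assoc] at h1
  exact h1

/-- If `f(x⁻¹ y) = g(y)` for all `y`, expand `f(x⁻¹ y z) = g(y z)` in powers of `z`. The difference
is a power series in `z` vanishing on all of `G`, and it remains to see that its linear coefficients
vanish. -/
theorem der_mem_lieAlgebra [IsDomain R] [CharZero R] (S : StandardGroup R d G)
    (hR : IsProPRing p R) (hp : p.Prime) (i : Fin d) :
    S.isFormalGroupLaw.der i ∈ S.lieAlgebra := by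
  classical
  intro x f g h y
  choose A hA using fun γ => S.exists_hasValue hR hp (S.isFormalGroupLaw.invOp γ f) (x⁻¹ * y)
  choose B hB using fun γ => S.exists_hasValue hR hp (S.isFormalGroupLaw.invOp γ g) y
  rw [IsFormalGroupLaw.der_apply, IsFormalGroupLaw.der_apply]
  refine ⟨A (single i 1), hA _, ?_⟩
  suffices A (single i 1) - B (single i 1) = 0 by
    rw [sub_eq_zero.mp this]; exact hB _
  have hsum : ∀ z : G, HasSum (fun γ => (A γ - B γ) * γ.prod fun i e => S.coord z i ^ e) 0 := by
    intro z
    obtain ⟨r, hr, hr'⟩ := h (y * z)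
    rw [← mul_assoc] at hr
    simpa [sub_mul] using (S.hasSum_invOp hR hp hr hA).sub (S.hasSum_invOp hR hp hr' hB)
  have := hR.t2Space
  have h0 : A 0 - B 0 = 0 := by
    have h1 : HasSum (fun γ => (A γ - B γ) * γ.prod fun i e => S.coord 1 i ^ e) (A 0 - B 0) := by
      convert hasSum_single (0 : Fin d →₀ ℕ) fun γ hγ => ?_ using 1
      · simp
      · obtain ⟨j, hj⟩ := Finsupp.ne_iff.mp hγ
        rw [Finsupp.prod, Finset.prod_eq_zero (i := j) (by simpa using hj), mul_zero]
        rw [coord_one, zero_pow hj]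
    exact h1.unique (hsum 1)
  -- At the point `z` with only nonzero coordinate `t = p ^ (k + 1)` in place `i`, every term except
  -- the linear one lies in `(t ^ 2)`. Hence `t` divides the `i`-th linear coefficient.
  refine hR.eq_zero_of_forall_dvd fun k => ?_
  have hpm : (p : R) ^ (k + 1) ∈ maximalIdeal R :=
    Ideal.pow_mem_of_mem _ hR.natCast_mem _ (Nat.succ_pos k)
  have hp0 : (p : R) ^ (k + 1) ≠ 0 := pow_ne_zero _ (by exact_mod_cast hp.ne_zero)
  set t := (p : R) ^ (k + 1)
  obtain ⟨z, hz⟩ := S.exists_coord_eq (a := Pi.single i t) fun j => by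
    by_cases hj : j = i
    · subst hj; simpa using hpm
    · simp [hj]
  have hmem := (hsum z).sub_mem_of_isClosed (hR.isClosed_ideal (Ideal.span {t ^ 2})) (single i 1)
    fun γ hγ => by
      by_cases hγ0 : γ = 0
      · subst hγ0; simp [h0]
      by_cases hex : ∃ j, j ≠ i ∧ γ j ≠ 0
      · obtain ⟨j, hji, hj⟩ := hex
        rw [Finsupp.prod, Finset.prod_eq_zero (i := j) (by simpa using hj), mul_zero]
        · exact zero_mem _
        · rw [hz, Pi.single_eq_of_ne hji, zero_pow hj]
      · push Not at hex
        have hγi : γ = single i (γ i) := by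
          ext j
          by_cases hj : j = i
          · subst hj; simp
          · rw [hex j hj, single_eq_of_ne hj]
        have h2 : 2 ≤ γ i := by
          by_contra hlt
          interval_cases hn : γ i
          · exact hγ0 (by rw [hγi, single_zero])
          · exact hγ hγi
        rw [hγi, Finsupp.prod_single_index (by simp), hz, Pi.single_eq_same]
        exact Ideal.mul_mem_left _ _ (Ideal.mem_span_singleton.mpr (pow_dvd_pow t h2))
  rw [Finsupp.prod_single_index (by simp), hz, Pi.single_eq_same, pow_one, zero_sub,
    neg_mem_iff, Ideal.mem_span_singleton, pow_two] at hmem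
  exact (pow_dvd_pow (p : R) (Nat.le_succ k)).trans ((mul_dvd_mul_iff_right hp0).mp hmem)

end StandardGroup

/-! ### The module topology of a finite module is `𝔪`-adic, compact and Hausdorff. -/

theorem IsLocalRing.eq_zero_of_forall_mem_pow_smul {R : Type*} [CommRing R] [IsNoetherianRing R]
    [IsLocalRing R] {M : Type*} [AddCommGroup M] [Module R M] [Module.Finite R M] {x : M}
    (h : ∀ k, x ∈ (IsLocalRing.maximalIdeal R ^ k • ⊤ : Submodule R M)) : x = 0 := by
  have := Ideal.iInf_pow_smul_eq_bot_of_isLocalRing (M := M) (IsLocalRing.maximalIdeal R)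
    (Ideal.IsPrime.ne_top inferInstance)
  rw [← Submodule.mem_bot R, ← this]
  simpa using h

section ModuleTopology

open IsLocalRing

namespace IsProPRing

variable {p : ℕ} {R : Type*} [CommRing R] [IsNoetherianRing R] [IsLocalRing R]
  [TopologicalSpace R] [IsTopologicalRing R]
  {M : Type*} [AddCommGroup M] [Module R M] [Module.Finite R M] [TopologicalSpace M]
  [IsModuleTopology R M]

theorem isOpen_pow_smul_top (hR : IsProPRing p R) (k : ℕ) :
    IsOpen ((maximalIdeal R ^ k • ⊤ : Submodule R M) : Set M) := by
  have := IsModuleTopology.topologicalAddGroup R M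
  obtain ⟨n, f, hf⟩ := Module.Finite.exists_fin' R M
  have hopen : IsOpen {y : Fin n → R | ∀ i, y i ∈ maximalIdeal R ^ k} := by
    have := isOpen_set_pi Set.finite_univ (s := fun _ : Fin n => ((maximalIdeal R ^ k : Ideal R) : Set R))
      fun _ _ => hR.isOpen_pow k
    simpa [Set.pi] using! this
  -- A surjection from `R ^ n` is open for the module topology, and it maps vectors with entries in
  -- `𝔪 ^ k` into `𝔪 ^ k M`.
  refine (maximalIdeal R ^ k • ⊤ : Submodule R M).toAddSubgroup.isOpen_of_mem_nhds
    (g := 0) (Filter.mem_of_superset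
      ((IsModuleTopology.isOpenQuotientMap_of_surjective hf).isOpenMap _ hopen |>.mem_nhds
        ⟨0, by simp, map_zero f⟩) ?_)
  rintro _ ⟨y, hy, rfl⟩
  rw [show y = ∑ i, y i • (Pi.single i (1 : R) : Fin n → R) by
    ext j; simp [Finset.sum_apply, Pi.single_apply], map_sum]
  refine Submodule.sum_mem (maximalIdeal R ^ k • ⊤ : Submodule R M) fun i _ => ?_
  rw [map_smul]
  exact Submodule.smul_mem_smul (hy i) trivial

theorem exists_pow_smul_top_le (hR : IsProPRing p R) (hp : p.Prime) {U : Set M}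
    (hU : U ∈ 𝓝 (0 : M)) :
    ∃ k : ℕ, ((maximalIdeal R ^ k • ⊤ : Submodule R M) : Set M) ⊆ U := by
  obtain ⟨n, f, hf⟩ := Module.Finite.exists_fin' R M
  have := IsModuleTopology.toContinuousAdd R M
  have hfc : Continuous f := IsModuleTopology.continuous_of_linearMap f
  have hV : f ⁻¹' U ∈ 𝓝 (0 : Fin n → R) := hfc.continuousAt (by rwa [map_zero])
  rw [nhds_pi, Filter.mem_pi'] at hV
  obtain ⟨I, t, ht, hI⟩ := hV
  choose k hk using fun i => hR.exists_pow_le hp (ht i)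
  refine ⟨Finset.univ.sup k, ?_⟩
  have hle : (maximalIdeal R ^ Finset.univ.sup k • ⊤ : Submodule R (Fin n → R)) ≤
      Submodule.pi Set.univ fun _ => (maximalIdeal R ^ Finset.univ.sup k : Ideal R) := by
    refine Submodule.smul_le.mpr fun r hr y _ => ?_
    simp only [Submodule.mem_pi, Set.mem_univ, forall_const, Pi.smul_apply, smul_eq_mul]
    exact fun i => Ideal.mul_mem_right _ _ hr
  have hmap : (maximalIdeal R ^ Finset.univ.sup k • ⊤ : Submodule R (Fin n → R)).map f =
      maximalIdeal R ^ Finset.univ.sup k • ⊤ := by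
    rw [Submodule.map_smul'', Submodule.map_top, LinearMap.range_eq_top.mpr hf]
  rw [← hmap]
  rintro _ ⟨y, hy, rfl⟩
  refine hI fun i _ => hk i ?_
  have := hle hy
  simp only [Submodule.mem_pi, Set.mem_univ, forall_const] at this
  exact Ideal.pow_le_pow_right (Finset.le_sup (Finset.mem_univ i)) (this i)

theorem t2Space_module (hR : IsProPRing p R) : T2Space M := by
  have := IsModuleTopology.topologicalAddGroup R M
  refine IsTopologicalAddGroup.t2Space_of_zero_sep fun x hx => ?_
  by_contra! h
  exact hx (eq_zero_of_forall_mem_pow_smul (R := R) fun k =>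
    h _ ((hR.isOpen_pow_smul_top k).mem_nhds (zero_mem _)))

theorem compactSpace_module (hR : IsProPRing p R) : CompactSpace M := by
  have := IsModuleTopology.toContinuousAdd R M
  have := hR.compactSpace
  exact Module.Finite.compactSpace R M

theorem isClosed_submodule (hR : IsProPRing p R) (N : Submodule R M) : IsClosed (N : Set M) := by
  have := IsModuleTopology.toContinuousAdd R M
  have := hR.compactSpace
  have := hR.t2Space_module (M := M)
  exact (Submodule.isCompact_of_fg (IsNoetherian.noetherian N)).isClosed

theorem nonarchimedean_module (hR : IsProPRing p R) (hp : p.Prime) :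
    NonarchimedeanAddGroup M :=
  { IsModuleTopology.topologicalAddGroup R M with
    is_nonarchimedean := fun U hU => by
      obtain ⟨k, hk⟩ := hR.exists_pow_smul_top_le hp hU
      exact ⟨⟨(maximalIdeal R ^ k • ⊤ : Submodule R M).toAddSubgroup,
        hR.isOpen_pow_smul_top k⟩, hk⟩ }

theorem summable_of_finite (hR : IsProPRing p R) (hp : p.Prime) {ι : Type*} {f : ι → M}
    (hf : ∀ k, {i | f i ∉ (maximalIdeal R ^ k • ⊤ : Submodule R M)}.Finite) : Summable f := by
  have := IsModuleTopology.topologicalAddGroup R M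
  let _ : UniformSpace M := IsTopologicalAddGroup.rightUniformSpace M
  have : IsUniformAddGroup M := isUniformAddGroup_of_addCommGroup
  have := hR.compactSpace_module (M := M)
  have := hR.nonarchimedean_module (M := M) hp
  refine NonarchimedeanAddGroup.summable_of_tendsto_cofinite_zero ?_
  refine Filter.tendsto_def.mpr fun U hU => ?_
  obtain ⟨k, hk⟩ := hR.exists_pow_smul_top_le hp hU
  refine Filter.mem_cofinite.mpr ((hf k).subset fun i hi h => hi (hk h))

theorem summable_of_finite' (hR : IsProPRing p R) (hp : p.Prime) {ι : Type*} {f : ι → R}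
    (hf : ∀ k, {i | f i ∉ maximalIdeal R ^ k}.Finite) : Summable f :=
  hR.summable_of_finite hp fun k => by simpa using hf k

end IsProPRing

end ModuleTopology

/-! ### Divisibility of `x ^ α / α!`. -/

section DividedPowers

open IsLocalRing

/-- `α!` divides `|α|!`, and Legendre's formula bounds the `p`-adic valuation of `n!` by `(n - 1) /
(p - 1)` for `n > 0`. For `α = 0` truncated subtraction leaves the correct bound `v = 0`. -/
theorem exists_multiFactorial_eq {p : ℕ} (hp : p.Prime) {d : ℕ} (α : Fin d →₀ ℕ) :
    ∃ v u : ℕ, multiFactorial α = p ^ v * u ∧ ¬ p ∣ u ∧ (p - 1) * v ≤ α.degree - 1 := by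
  have := Fact.mk hp
  obtain ⟨v, u, hu, h⟩ := Nat.exists_eq_pow_mul_and_not_dvd (multiFactorial_ne_zero α) p hp.ne_one
  refine ⟨v, u, h, hu, ?_⟩
  by_cases h0 : α = 0
  · subst h0
    have : v = 0 := by
      by_contra hv
      have : p ∣ 1 := by
        rw [multiFactorial_zero] at h
        exact h ▸ (dvd_pow_self p hv).mul_right u
      exact hp.one_lt.ne' (Nat.dvd_one.mp this)
    simp [this]
  have hdeg : α.degree ≠ 0 := fun h => h0 ((Finsupp.degree_eq_zero_iff α).mp h)
  have hdvd : p ^ v ∣ (α.degree).factorial := by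
    refine (Dvd.intro u h.symm).trans ?_
    rw [Finsupp.degree_eq_sum]
    exact Nat.prod_factorial_dvd_factorial_sum _ _
  have hv : v ≤ padicValNat p (α.degree).factorial :=
    (padicValNat_dvd_iff_le (Nat.factorial_ne_zero _)).mp hdvd
  have := sub_one_mul_padicValNat_factorial_lt_of_ne_zero p hdeg
  have := Nat.mul_le_mul_left (p - 1) hv
  omega

namespace IsProPRing

variable {p : ℕ} {R : Type*} [CommRing R] [IsDomain R] [CharZero R]
  [IsNoetherianRing R] [IsLocalRing R]
  [TopologicalSpace R] [IsTopologicalRing R]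

theorem isUnit_natCast (hR : IsProPRing p R) (hp : p.Prime) {u : ℕ} (hu : ¬ p ∣ u) :
    IsUnit (u : R) := by
  by_contra h
  have hum : (u : R) ∈ maximalIdeal R := h
  have hc : IsCoprime (p : ℤ) u := Nat.isCoprime_iff_coprime.mpr
    ((Nat.Prime.coprime_iff_not_dvd hp).mpr hu)
  obtain ⟨a, b, hab⟩ := hc
  have h1 : (a : R) * p + b * u = 1 := by exact_mod_cast congrArg (Int.cast : ℤ → R) hab
  exact (Ideal.ne_top_iff_one _).mp (Ideal.IsPrime.ne_top (I := maximalIdeal R) inferInstance)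
    (h1 ▸ add_mem (Ideal.mul_mem_left _ _ hR.natCast_mem) (Ideal.mul_mem_left _ _ hum))

theorem pow_dvd_of_multiFactorial_mul_eq (hR : IsProPRing p R) (hp : p.Prime) {d : ℕ}
    {α : Fin d →₀ ℕ} {v u N : ℕ} (h : multiFactorial α = p ^ v * u) (hu : ¬ p ∣ u) (hN : v ≤ N)
    {D c : R} (hD : (multiFactorial α : R) * D = (p : R) ^ N * c) : (p : R) ^ (N - v) ∣ D := by
  have hp0 : (p : R) ^ v ≠ 0 := pow_ne_zero _ (by exact_mod_cast hp.ne_zero)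
  rw [h, ← Nat.add_sub_cancel' hN, pow_add] at hD
  push_cast at hD
  rw [mul_assoc, mul_assoc] at hD
  have := mul_left_cancel₀ hp0 hD
  exact ((hR.isUnit_natCast hp hu).dvd_mul_left).mp ⟨c, this⟩

/-- For odd `p` the valuation of `α!` is at most `(|α| - 1) / 2`, leaving at least half of `p ^
|α|`. For `p = 2` it can be `|α| - 1`, so powers of `2` would not suffice for decay, whereas `4 ^
|α|` leaves more than `|α|` factors. -/
theorem exists_divided_pow (hR : IsProPRing p R) (hp : p.Prime) {d : ℕ} (α : Fin d →₀ ℕ) :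
    ∃ κ : R, (multiFactorial α : R) * κ = (boldP p : R) ^ α.degree ∧
      ∃ e, α.degree ≤ 2 * e ∧ (p : R) ^ e ∣ κ := by
  obtain ⟨v, u, h, hu, hv⟩ := exists_multiFactorial_eq hp α
  obtain ⟨w, hw⟩ := (hR.isUnit_natCast hp hu).exists_right_inv
  obtain ⟨N, hN, hvN, hN2⟩ : ∃ N, boldP p ^ α.degree = p ^ N ∧ v ≤ N ∧ α.degree ≤ 2 * (N - v) := by
    by_cases h2 : p = 2
    · subst h2
      refine ⟨2 * α.degree, ?_, ?_, ?_⟩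
      · rw [boldP, if_pos rfl, pow_mul]; norm_num
      · simp at hv; omega
      · simp at hv; omega
    · refine ⟨α.degree, by rw [boldP, if_neg h2], ?_⟩
      have : 3 ≤ p := by have := hp.two_le; omega
      have : 2 * v ≤ (p - 1) * v := Nat.mul_le_mul_right _ (by omega)
      omega
  have hN' : (boldP p : R) ^ α.degree = (p : R) ^ N := by exact_mod_cast congrArg (Nat.cast (R := R)) hN
  refine ⟨(p : R) ^ (N - v) * w, ?_, N - v, hN2, Dvd.intro _ rfl⟩
  rw [hN', h]
  push_cast
  calc (p : R) ^ v * u * ((p : R) ^ (N - v) * w) = (p ^ v * p ^ (N - v)) * (u * w) := by ring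
    _ = p ^ N := by rw [hw, mul_one, ← pow_add, Nat.add_sub_cancel' hvN]

/-- The valuation is at least `j |α| - (|α| - 1) = (j - 1) |α| + 1`, which for `|α| ≥ 2` is at least
`2 j - 1`. This makes the higher terms negligible against the linear ones. -/
theorem pow_dvd_divided_pow (hR : IsProPRing p R) (hp : p.Prime) {d : ℕ} {α : Fin d →₀ ℕ}
    {x : Fin d → R} {D : R} (hD : (multiFactorial α : R) * D = α.prod fun i e => x i ^ e)
    {j : ℕ} (hj : 1 ≤ j) (hx : ∀ i, (p : R) ^ j ∣ x i) (hα : 2 ≤ α.degree) :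
    (p : R) ^ (2 * j - 1) ∣ D := by
  obtain ⟨v, u, h, hu, hv⟩ := exists_multiFactorial_eq hp α
  choose y hy using hx
  have hv' : v ≤ α.degree - 1 :=
    le_trans (Nat.le_mul_of_pos_left v (by have := hp.two_le; omega)) hv
  have hprod : (α.prod fun i e => x i ^ e) = (p : R) ^ (j * α.degree) * α.prod fun i e => y i ^ e := by
    simp only [hy, mul_pow]
    rw [Finsupp.prod_mul, Finsupp.prod, Finset.prod_pow_eq_pow_sum, pow_mul]
    rfl
  have hle : α.degree ≤ j * α.degree := Nat.le_mul_of_pos_left _ hj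
  rw [hprod] at hD
  refine (pow_dvd_pow _ ?_).trans (hR.pow_dvd_of_multiFactorial_mul_eq hp h hu (by omega) hD)
  obtain ⟨j, rfl⟩ := Nat.exists_eq_add_of_le hj
  obtain ⟨n, hn⟩ := Nat.exists_eq_add_of_le hα
  rw [hn] at hv' ⊢
  have : (1 + j) * (2 + n) = 2 + n + 2 * j + j * n := by ring
  omega

end IsProPRing

end DividedPowers

/-! ### Multiplying two exponential-like series. -/

namespace IsProPRing

open IsLocalRing

variable {p : ℕ} {R : Type*} [CommRing R] [IsDomain R] [CharZero R]
  [IsNoetherianRing R] [IsLocalRing R] [TopologicalSpace R] [IsTopologicalRing R]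
  {E : Type*} [Ring E] [Algebra R E] [Module.Finite R E] [TopologicalSpace E]
  [IsModuleTopology R E]

theorem smul_mem_pow_smul_top {r : R} {k : ℕ} (hr : r ∈ maximalIdeal R ^ k) (x : E) :
    r • x ∈ (maximalIdeal R ^ k • ⊤ : Submodule R E) := Submodule.smul_mem_smul hr trivial

theorem summable_smul (hR : IsProPRing p R) (hp : p.Prime) {ι : Type*} {D : ι → R}
    (hD : ∀ k, {i | D i ∉ maximalIdeal R ^ k}.Finite) (ρ : ι → E) :
    Summable fun i => D i • ρ i :=
  hR.summable_of_finite hp fun k =>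
    (hD k).subset fun i hi h => hi (smul_mem_pow_smul_top h (ρ i))

/-- Two exponential-like series multiply like a group law, if their coefficients multiply like
the divided powers `x ^ α / α!` and the dual elements of an enveloping algebra. -/
theorem hasSum_smul_mul (hR : IsProPRing p R) (hp : p.Prime) {ι : Type*} {ρ : ι → E}
    {m : ι → ℕ} (hm : ∀ α, m α ≠ 0) {c : ι → ι → ι → R} {e : ι → ι → ι →₀ R}
    (he : ∀ β γ, ρ β * ρ γ = (e β γ).sum fun α r => r • ρ α)
    (hec : ∀ α β γ, (m β : R) * m γ * c α β γ = m α * e β γ α)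
    {X Y Z : ι → R} (hX : ∀ k, {i | X i ∉ maximalIdeal R ^ k}.Finite)
    (hY : ∀ k, {i | Y i ∉ maximalIdeal R ^ k}.Finite)
    (hZ : ∀ α, HasSum (fun q : ι × ι => c α q.1 q.2 * ((m q.1 * X q.1) * (m q.2 * Y q.2)))
      (m α * Z α)) {a b : E} (ha : HasSum (fun α => X α • ρ α) a)
    (hb : HasSum (fun α => Y α • ρ α) b) : HasSum (fun α => Z α • ρ α) (a * b) := by
  have hEr := IsModuleTopology.isTopologicalRing R E
  have hEn := hR.nonarchimedean_module (M := E) hp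
  have : NonarchimedeanRing E := { hEr with is_nonarchimedean := hEn.is_nonarchimedean }
  have := hR.t2Space
  have := hR.t2Space_module (M := E)
  have hab : HasSum (fun q : ι × ι => (X q.1 • ρ q.1) * (Y q.2 • ρ q.2)) (a * b) := by
    let _ : UniformSpace E := IsTopologicalAddGroup.rightUniformSpace E
    have : IsUniformAddGroup E := isUniformAddGroup_of_addCommGroup
    exact ha.mul_of_nonarchimedean hb
  have hfin : ∀ k, {q : ι × ι | X q.1 * Y q.2 ∉ maximalIdeal R ^ k}.Finite := fun k =>
    ((hX k).prod (hY k)).subset fun q hq =>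
      ⟨fun h => hq (Ideal.mul_mem_right _ _ h), fun h => hq (Ideal.mul_mem_left _ _ h)⟩
  -- Each `e β γ` has finite support, so the triple family also tends to zero and may be summed over
  -- pairs first or over `α` first.
  have htriple : ∀ k, {t : (ι × ι) × ι |
      X t.1.1 * Y t.1.2 * e t.1.1 t.1.2 t.2 ∉ maximalIdeal R ^ k}.Finite := fun k => by
    refine ((hfin k).biUnion fun q _ =>
      (((e q.1 q.2).support : Set ι).toFinite.image fun α => (q, α))).subset ?_
    rintro ⟨q, α⟩ h
    refine Set.mem_biUnion (x := q) (fun h' => h (Ideal.mul_mem_right _ _ h')) ⟨α, ?_, rfl⟩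
    rw [Finset.mem_coe, Finsupp.mem_support_iff]
    intro h0
    exact h (by simp [h0])
  have hsum := (hR.summable_smul hp htriple fun t => ρ t.2).hasSum
  have h1 := hsum.prod_fiberwise (g := fun q => (X q.1 • ρ q.1) * (Y q.2 • ρ q.2)) fun q => by
    have hq : (X q.1 • ρ q.1) * (Y q.2 • ρ q.2) =
        ∑ α ∈ (e q.1 q.2).support, (X q.1 * Y q.2 * e q.1 q.2 α) • ρ α := by
      rw [smul_mul_smul_comm, he, Finsupp.sum, Finset.smul_sum]
      exact Finset.sum_congr rfl fun α _ => smul_smul _ _ _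
    rw [hq]
    refine hasSum_sum_of_ne_finset_zero fun α hα => ?_
    rw [Finsupp.notMem_support_iff.mp hα, mul_zero, zero_smul]
  rw [← hab.unique h1] at hsum
  have hsum' := (Equiv.prodComm ι (ι × ι)).hasSum_iff.mpr hsum
  refine hsum'.prod_fiberwise fun α => ?_
  have hs : Summable fun q : ι × ι => X q.1 * Y q.2 * e q.1 q.2 α :=
    hR.summable_of_finite' hp fun k =>
      (hfin k).subset fun q hq h => hq (Ideal.mul_mem_right _ _ h)
  -- Multiplying by `m α` turns the constants `e` into `c`; the sum becomes the one in `hZ`, after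
  -- which `m α` is cancelled.
  have hval : (m α : R) * ∑' q : ι × ι, X q.1 * Y q.2 * e q.1 q.2 α = m α * Z α := by
    refine (hs.hasSum.mul_left (m α : R)).unique ?_
    have hq : (fun q : ι × ι => (m α : R) * (X q.1 * Y q.2 * e q.1 q.2 α)) =
        fun q => c α q.1 q.2 * ((m q.1 * X q.1) * (m q.2 * Y q.2)) := funext fun q => by
      calc (m α : R) * (X q.1 * Y q.2 * e q.1 q.2 α) =
          X q.1 * Y q.2 * (m α * e q.1 q.2 α) := by ring
        _ = _ := by rw [← hec]; ring
    rw [hq]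
    exact hZ α
  have hval' := mul_left_cancel₀ (by exact_mod_cast hm α) hval
  have := hs.hasSum.smul_const (ρ α)
  rw [hval'] at this
  exact this

end IsProPRing

/-! ### Approximating products and `p`-power maps in a standard group. -/

theorem HasSum.sub_sum_mem_of_isClosed {ι M S : Type*} [AddCommGroup M] [TopologicalSpace M]
    [IsTopologicalAddGroup M] [SetLike S M] [AddSubmonoidClass S M] {s : S}
    (hs : IsClosed (s : Set M)) {f : ι → M} {a : M} (hf : HasSum f a) (T : Finset ι)
    (h : ∀ j, j ∉ T → f j ∈ s) : a - ∑ i ∈ T, f i ∈ s := by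
  classical
  have hg : HasSum (fun i => if i ∈ T then f i else 0) (∑ i ∈ T, if i ∈ T then f i else 0) :=
    hasSum_sum_of_ne_finset_zero fun i hi => if_neg hi
  rw [Finset.sum_congr rfl fun i hi => if_pos hi] at hg
  refine (hf.sub hg).mem_of_isClosed hs fun j => ?_
  by_cases hj : j ∈ T
  · simp [hj]
  · simpa [hj] using h j hj

theorem Finsupp.pow_degree_dvd_prod_pow {R : Type*} [CommRing R] {σ : Type*} {q : R} {x : σ → R}
    (hx : ∀ i, q ∣ x i) (α : σ →₀ ℕ) : q ^ α.degree ∣ α.prod fun i e => x i ^ e := by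
  rw [Finsupp.degree_apply, ← Finset.prod_pow_eq_pow_sum]
  exact Finset.prod_dvd_prod_of_dvd _ _ fun i _ => pow_dvd_pow_of_dvd (hx i) _

namespace StandardGroup

open MvPowerSeries Finsupp IsLocalRing

variable {p : ℕ} {R : Type*} [CommRing R] [IsNoetherianRing R] [IsLocalRing R]
  [TopologicalSpace R] [IsTopologicalRing R] {d : ℕ} {G : Type*} [Group G] [TopologicalSpace G]

/-- The term of the series `F_i(x, y)` at a pair of multi-indices. -/
noncomputable def term (S : StandardGroup R d G) (x y : G) (i : Fin d)
    (q : (Fin d →₀ ℕ) × (Fin d →₀ ℕ)) : R :=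
  coeff (q.1.sumElim q.2) (S.law i) *
    ((q.1.prod fun i e => S.coord x i ^ e) * q.2.prod fun i e => S.coord y i ^ e)

theorem hasSum_term (S : StandardGroup R d G) (x y : G) (i : Fin d) :
    HasSum (S.term x y i) (S.coord (x * y) i) := by
  have h := S.hasValueAt_mul x y i
  rw [HasValueAt, ← sumFinsuppEquivProdFinsupp.symm.hasSum_iff] at h
  convert h using 1
  funext q
  obtain ⟨β, γ⟩ := q
  change _ = coeff (β.sumElim γ) _ * (β.sumElim γ).prod _
  rw [prod_sumElim]
  rfl

theorem term_left (S : StandardGroup R d G) (x y : G) (i : Fin d) (β : Fin d →₀ ℕ)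
    [Decidable (β = single i 1)] :
    S.term x y i (β, 0) = if β = single i 1 then S.coord x i else 0 := by
  classical
  rw [term, ← coeff_coeffRight, S.isFormalGroupLaw.coeffRight_zero, coeff_X]
  split_ifs with h
  · subst h; simp
  · simp

theorem term_right (S : StandardGroup R d G) (x y : G) (i : Fin d) (γ : Fin d →₀ ℕ)
    [Decidable (γ = single i 1)] :
    S.term x y i (0, γ) = if γ = single i 1 then S.coord y i else 0 := by
  classical
  rw [term, ← coeff_coeffLeft, S.isFormalGroupLaw.coeffLeft_zero, coeff_X]
  split_ifs with h
  · subst h; simp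
  · simp

/-- As `F(0, Y) = Y`, every other term of `F_i` contains some coordinate of `x`. Taking `y = x⁻¹`
also gives closure of `G(I)` under inverses. -/
theorem coord_mul_sub_mem (S : StandardGroup R d G) (hR : IsProPRing p R) {I : Ideal R} {x : G}
    (hx : ∀ i, S.coord x i ∈ I) (y : G) (i : Fin d) :
    S.coord (x * y) i - S.coord y i ∈ I := by
  classical
  have h := (S.hasSum_term x y i).sub_mem_of_isClosed (hR.isClosed_ideal I) (0, single i 1) ?_
  · rwa [term_right, if_pos rfl] at h
  · rintro ⟨β, γ⟩ hne
    by_cases hβ : β = 0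
    · subst hβ
      rw [term_right, if_neg (by rintro rfl; exact hne rfl)]
      exact zero_mem I
    · obtain ⟨j, hj⟩ := Finsupp.ne_iff.mp hβ
      refine Ideal.mul_mem_left _ _ (Ideal.mul_mem_right _ _ ?_)
      exact Ideal.mem_of_dvd _ (Finset.dvd_prod_of_mem _ (by simpa using hj))
        (Ideal.pow_mem_of_mem _ (hx j) _ (Nat.pos_of_ne_zero hj))

/-- The subgroup `G(I)`. -/
noncomputable def pointsSubgroup (S : StandardGroup R d G) (hR : IsProPRing p R) (I : Ideal R) :
    Subgroup G where
  carrier := S.points I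
  one_mem' i := by
    change S.coord 1 i ∈ I
    simp
  mul_mem' {x y} hx hy i := by
    have := add_mem (S.coord_mul_sub_mem hR (I := I) hx y i) (show S.coord y i ∈ I from hy i)
    rw [sub_add_cancel] at this
    exact this
  inv_mem' {x} hx i := by
    have := S.coord_mul_sub_mem hR (I := I) hx x⁻¹ i
    rw [mul_inv_cancel, coord_one, zero_sub, neg_mem_iff] at this
    exact this

/-- The bilinear part of the `i`-th component of the group law. -/
noncomputable def bilin (S : StandardGroup R d G) (i : Fin d) (x y : Fin d → R) : R :=
  ∑ q : Fin d × Fin d,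
    coeff ((single q.1 1).sumElim (single q.2 1)) (S.law i) * (x q.1 * y q.2)

theorem dvd_bilin (S : StandardGroup R d G) (i : Fin d) {x y : Fin d → R} {a b : R}
    (hx : ∀ i, a ∣ x i) (hy : ∀ i, b ∣ y i) : a * b ∣ S.bilin i x y :=
  Finset.dvd_sum fun _ _ => (mul_dvd_mul (hx _) (hy _)).mul_left _

theorem bilin_add_smul (S : StandardGroup R d G) (i : Fin d) (n : R) (x w y : Fin d → R) :
    S.bilin i (fun a => n * x a + w a) y = n * S.bilin i x y + S.bilin i w y := by
  rw [bilin, bilin, bilin, Finset.mul_sum, ← Finset.sum_add_distrib]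
  exact Finset.sum_congr rfl fun q _ => by ring

/-- The terms of `F_i` in `X` alone or `Y` alone reduce to `X_i` and `Y_i`, so what is left beyond
the bilinear part has degree at least three. -/
theorem pow_dvd_coord_mul_sub (S : StandardGroup R d G) (hR : IsProPRing p R) {q : R} {x y : G}
    (hx : ∀ i, q ∣ S.coord x i) (hy : ∀ i, q ∣ S.coord y i) (i : Fin d) :
    q ^ 3 ∣ S.coord (x * y) i -
      (S.coord x i + S.coord y i + S.bilin i (S.coord x) (S.coord y)) := by
  classical
  let E : Fin d × Fin d → (Fin d →₀ ℕ) × (Fin d →₀ ℕ) := fun a => (single a.1 1, single a.2 1)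
  have hE : Function.Injective E := by
    rintro ⟨a, b⟩ ⟨a', b'⟩ h
    simp only [E, Prod.mk.injEq, single_left_inj one_ne_zero] at h
    rw [h.1, h.2]
  have hne : ∀ j : Fin d, single j 1 ≠ (0 : Fin d →₀ ℕ) := fun j => by simp
  let T : Finset ((Fin d →₀ ℕ) × (Fin d →₀ ℕ)) :=
    insert (single i 1, 0) (insert (0, single i 1) (Finset.univ.map ⟨E, hE⟩))
  have h := (S.hasSum_term x y i).sub_sum_mem_of_isClosed
    (hR.isClosed_ideal (Ideal.span {q ^ 3})) T ?_
  · have hsum : ∑ n ∈ T, S.term x y i n =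
        S.coord x i + S.coord y i + S.bilin i (S.coord x) (S.coord y) := by
      rw [Finset.sum_insert, Finset.sum_insert, Finset.sum_map, term_left, term_right,
        if_pos rfl, if_pos rfl, add_assoc, bilin]
      · congr 2
        refine Finset.sum_congr rfl fun a _ => ?_
        simp [term, E]
      · simp [E, hne]
      · simp [E, hne]
    rwa [hsum, Ideal.mem_span_singleton] at h
  · rintro ⟨β, γ⟩ hT
    rw [Ideal.mem_span_singleton]
    by_cases hγ : γ = 0
    · subst hγ
      rw [term_left, if_neg (by rintro rfl; exact hT (Finset.mem_insert_self _ _))]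
      exact dvd_zero _
    by_cases hβ : β = 0
    · subst hβ
      rw [term_right, if_neg (by rintro rfl; exact hT (by simp [T]))]
      exact dvd_zero _
    have hβ' : β.degree ≠ 0 := fun h => hβ ((Finsupp.degree_eq_zero_iff _).mp h)
    have hγ' : γ.degree ≠ 0 := fun h => hγ ((Finsupp.degree_eq_zero_iff _).mp h)
    have hdeg : 3 ≤ β.degree + γ.degree := by
      by_contra hlt
      obtain ⟨a, rfl⟩ := exists_eq_single_of_degree_eq_one (α := β) (by omega)
      obtain ⟨b, rfl⟩ := exists_eq_single_of_degree_eq_one (α := γ) (by omega)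
      exact hT (by simp [T, E])
    refine Dvd.dvd.mul_left ((pow_dvd_pow q hdeg).trans ?_) _
    rw [pow_add]
    exact mul_dvd_mul (pow_degree_dvd_prod_pow hx β) (pow_degree_dvd_prod_pow hy γ)

theorem dvd_coord_pow (S : StandardGroup R d G) (hR : IsProPRing p R) {q : R} {x : G}
    (hx : ∀ i, q ∣ S.coord x i) (n : ℕ) (i : Fin d) : q ∣ S.coord (x ^ n) i := by
  have h := (S.pointsSubgroup hR (Ideal.span {q})).pow_mem
    (x := x) (fun i => Ideal.mem_span_singleton.mpr (hx i)) n
  exact Ideal.mem_span_singleton.mp (h i)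

theorem pow_dvd_coord_pow_sub (S : StandardGroup R d G) (hR : IsProPRing p R) {q : R} {x : G}
    (hx : ∀ i, q ∣ S.coord x i) (n : ℕ) (i : Fin d) :
    q ^ 3 ∣ S.coord (x ^ n) i -
      (n * S.coord x i + (n.choose 2 : ℕ) * S.bilin i (S.coord x) (S.coord x)) := by
  induction n generalizing i with
  | zero => simp
  | succ n ih =>
    have h1 := S.pow_dvd_coord_mul_sub hR (S.dvd_coord_pow hR hx n) hx i
    rw [← pow_succ] at h1
    have hw : S.bilin i (S.coord (x ^ n)) (S.coord x) =
        n * S.bilin i (S.coord x) (S.coord x) +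
          S.bilin i (fun a => S.coord (x ^ n) a - n * S.coord x a) (S.coord x) := by
      rw [← bilin_add_smul]
      simp
    -- By induction `x ^ n` and `n x` agree modulo `q ^ 2`, so replacing one by the other in the
    -- bilinear form costs a multiple of `q ^ 3`.
    have h2 : q ^ 3 ∣ S.bilin i (fun a => S.coord (x ^ n) a - n * S.coord x a) (S.coord x) := by
      rw [pow_succ]
      refine S.dvd_bilin i (fun a => ?_) hx
      have h3 := (pow_dvd_pow q (show 2 ≤ 3 by norm_num)).trans (ih a)
      have h4 : q ^ 2 ∣ ((n.choose 2 : ℕ) : R) * S.bilin a (S.coord x) (S.coord x) := by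
        rw [pow_two]
        exact (S.dvd_bilin a hx hx).mul_left _
      have := dvd_add h3 h4
      rwa [sub_add_eq_sub_sub, sub_add_cancel] at this
    have hch : (((n + 1).choose 2 : ℕ) : R) = n + (n.choose 2 : ℕ) := by
      rw [Nat.choose_succ_succ' n 1, Nat.choose_one_right]; push_cast; ring
    have := dvd_add (dvd_add h1 h2) (ih i)
    convert this using 1
    rw [hw, hch]
    push_cast
    ring

/-- For odd `p` the binomial `p.choose 2` supplies the extra factor, as `1 + 2 j ≥ j + 2`. For `p =
2` it does not, and `2 j ≥ j + 2` forces `j ≥ 2`, in accordance with `𝐩 = 4`. -/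
theorem pow_dvd_coord_pow_prime_sub (S : StandardGroup R d G) (hR : IsProPRing p R)
    (hp : p.Prime) {j : ℕ} (hj : 1 ≤ j) (hj2 : p = 2 → 2 ≤ j) {x : G}
    (hx : ∀ i, (p : R) ^ j ∣ S.coord x i) (i : Fin d) :
    (p : R) ^ (j + 2) ∣ S.coord (x ^ p) i - p * S.coord x i := by
  have h1 := S.pow_dvd_coord_pow_sub hR hx p i
  rw [← pow_mul] at h1
  have hB := S.dvd_bilin i hx hx
  rw [← pow_add] at hB
  have h2 : (p : R) ^ (j + 2) ∣ ((p.choose 2 : ℕ) : R) * S.bilin i (S.coord x) (S.coord x) := by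
    by_cases h2 : p = 2
    · exact ((pow_dvd_pow _ (by have := hj2 h2; omega)).trans hB).mul_left _
    · have hpc : (p : R) ∣ (p.choose 2 : ℕ) :=
        Nat.cast_dvd_cast (hp.dvd_choose_self two_ne_zero (by have := hp.two_le; omega))
      refine (pow_dvd_pow _ (show j + 2 ≤ 1 + (j + j) by omega)).trans ?_
      rw [pow_add, pow_one]
      exact mul_dvd_mul hpc hB
  have h3 := dvd_add ((pow_dvd_pow _ (show j + 2 ≤ j * 3 by
    by_cases h2 : p = 2 <;> [have := hj2 h2; skip] <;> omega)).trans h1) h2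
  rwa [sub_add_eq_sub_sub, sub_add_cancel] at h3

theorem exists_coord_pow_prime_pow (S : StandardGroup R d G) (hR : IsProPRing p R)
    (hp : p.Prime) {j : ℕ} (hj : 1 ≤ j) (hj2 : p = 2 → 2 ≤ j) {x : G} {y₀ : Fin d → R}
    (hx : ∀ i, S.coord x i = p ^ j * y₀ i) (n : ℕ) :
    ∃ y : Fin d → R, (∀ i, S.coord (x ^ p ^ n) i = p ^ (j + n) * y i) ∧
      ∀ i, (p : R) ∣ y i - y₀ i := by
  induction n with
  | zero => exact ⟨y₀, by simpa using hx, by simp⟩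
  | succ n ih =>
    obtain ⟨y, hy, hyy⟩ := ih
    have h := S.pow_dvd_coord_pow_prime_sub hR hp (j := j + n) (by omega)
      (fun h => by have := hj2 h; omega) (x := x ^ p ^ n) fun i => ⟨_, hy i⟩
    choose z hz using h
    refine ⟨fun i => y i + p * z i, fun i => ?_, fun i => ?_⟩
    · rw [pow_succ p n, pow_mul, sub_eq_iff_eq_add.mp (hz i), hy]
      ring
    · rw [add_sub_right_comm]
      exact dvd_add (hyy i) (Dvd.intro _ rfl)

end StandardGroup

/-! ### Extending the embedding of `L(G)` to the rescaled invariant operators. -/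

namespace StandardGroup

open MvPowerSeries Finsupp IsLocalRing

variable {p : ℕ} {R : Type*} [CommRing R] [IsNoetherianRing R] [IsLocalRing R] [IsDomain R]
  [CharZero R] [TopologicalSpace R] [IsTopologicalRing R] {d : ℕ} {G : Type*} [Group G]
  [TopologicalSpace G]

theorem linearIndependent_der (S : StandardGroup R d G) (hR : IsProPRing p R) (hp : p.Prime) :
    LinearIndependent R fun i => (⟨_, S.der_mem_lieAlgebra hR hp i⟩ : S.lieAlgebra) := by
  classical
  refine Fintype.linearIndependent_iff.mpr fun g hg j => ?_
  let ℓ : S.lieAlgebra →ₗ[R] R :=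
    { toFun := fun w => coeff 0 (w.1 (monomial (single j 1) 1))
      map_add' := fun v w => by simp
      map_smul' := fun r w => by simp }
  have h := congrArg ℓ hg
  have h' : ∑ i, g i * ℓ ⟨_, S.der_mem_lieAlgebra hR hp i⟩ = 0 := by
    rwa [map_sum, map_zero, Finset.sum_congr rfl fun i _ => map_smul ℓ (g i) _] at h
  have hl : ∀ i, ℓ ⟨_, S.der_mem_lieAlgebra hR hp i⟩ = if i = j then 1 else 0 := fun i => by
    change coeff 0 (S.isFormalGroupLaw.der i _) = _
    rw [IsFormalGroupLaw.der_apply, ← IsFormalGroupLaw.powOp_single,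
      IsFormalGroupLaw.coeff_zero_powOp_monomial]
    simp [single_left_inj]
  simpa [hl] using h'

/-- An embedding of the Lie algebra extends to the operators `powOp`, with the multiplication
constants of their duals. -/
theorem exists_extension (S : StandardGroup R d G) (hR : IsProPRing p R) (hp : p.Prime)
    {E : Type*} [Ring E] [Algebra R E] (ι : S.lieAlgebra →ₗ⁅R⁆ E) :
    ∃ (ρ : (Fin d →₀ ℕ) → E) (e : (Fin d →₀ ℕ) → (Fin d →₀ ℕ) → (Fin d →₀ ℕ) →₀ R),
      ρ 0 = 1 ∧ (∀ i, ρ (single i 1) = ι ⟨_, S.der_mem_lieAlgebra hR hp i⟩) ∧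
      (∀ β γ, ρ β * ρ γ = (e β γ).sum fun α r => r • ρ α) ∧
      ∀ α β γ, (multiFactorial β : R) * multiFactorial γ *
        coeff β (S.isFormalGroupLaw.invOp γ (monomial α 1)) = multiFactorial α * e β γ α := by
  classical
  set hF := S.isFormalGroupLaw with hFdef
  let δ : Fin d → S.lieAlgebra := fun i => ⟨_, S.der_mem_lieAlgebra hR hp i⟩
  -- The graph of `ι` on the invariant derivations, inside the product algebra; the first projection
  -- plays the role of `π`.
  let t : Fin d → Module.End R (MvPowerSeries (Fin d) R) × E :=
    fun i => (hF.invOp (single i 1), ι (δ i))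
  let θ : S.lieAlgebra →ₗ[R] Module.End R (MvPowerSeries (Fin d) R) × E :=
    { toFun := fun w => (w.1.toLinearMap, ι w)
      map_add' := fun v w => by ext <;> simp
      map_smul' := fun r w => by ext <;> simp }
  have hθ : ∀ i, θ (δ i) = t i := fun i => by
    refine Prod.ext (LinearMap.ext fun f => ?_) rfl
    exact hF.der_apply i f
  have hcomm : ∀ i j, t i * t j - t j * t i ∈ Submodule.span R (Set.range t) := fun i j => by
    have h1 : t i * t j - t j * t i = θ ⁅δ i, δ j⁆ := by
      rw [← hθ, ← hθ]
      refine Prod.ext ?_ ?_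
      · change _ = (⁅(δ i).1, (δ j).1⁆).toLinearMap
        rw [Derivation.commutator_coe_linear_map]
        rfl
      · change _ = ι _
        rw [LieHom.map_lie]
        rfl
    obtain ⟨c, hc⟩ := (Submodule.mem_span_range_iff_exists_fun R).mp (hF.invOp_commutator_mem i j)
    -- The first component of `θ` is faithful on `L(G)`, so a bracket relation between operators
    -- holds in `L(G)` and is carried over by `ι`.
    have h2 : ⁅δ i, δ j⁆ = ∑ k, c k • δ k := by
      have hfst : ∀ v w : S.lieAlgebra, (θ v).1 = (θ w).1 → v = w := fun v w h =>
        Subtype.ext (Derivation.ext fun f => LinearMap.congr_fun h f)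
      refine hfst _ _ ?_
      rw [← h1, map_sum, Prod.fst_sum]
      simp only [map_smul, hθ]
      exact hc.symm
    rw [h1, h2, map_sum]
    refine Submodule.sum_mem _ fun k _ => ?_
    rw [map_smul, hθ]
    exact Submodule.smul_mem _ _ (Submodule.subset_span ⟨k, rfl⟩)
  obtain ⟨τ, h0, h1, hπ, hτ⟩ := OrderedMonomial.exists_lift (t := t)
    (π := AlgHom.fst R (Module.End R (MvPowerSeries (Fin d) R)) E)
    hF.linearIndependent_powOp hF.powOp_zero
    (fun β i => by rw [hF.powOp_single]; exact hF.powOp_mul_sub_mem β i)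
    (fun i => (hF.powOp_single i).symm) hcomm
  choose e he using hτ
  refine ⟨fun α => (τ α).2, e, congrArg Prod.snd h0, fun i => congrArg Prod.snd (h1 i), fun β γ => ?_,
    fun α β γ => ?_⟩
  · have := congrArg (AlgHom.snd R _ E) (he β γ)
    rw [Finsupp.sum, map_sum] at this
    simpa [Finsupp.sum] using this
  -- In the first factor the relation concerns the operators themselves. Applying it to `X ^ α` and
  -- evaluating at the origin isolates `α! e(α; β, γ)`.
  · have := congrArg (AlgHom.fst R _ E) (he β γ)
    rw [map_mul, hπ, hπ, Finsupp.sum, map_sum] at this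
    simp only [map_smul, hπ] at this
    have h := congrArg (fun T => coeff 0 (T (monomial α 1))) this
    simp only [Module.End.mul_apply, LinearMap.sum_apply, map_sum, LinearMap.smul_apply, map_smul,
      hF.coeff_zero_powOp_monomial, smul_eq_mul] at h
    rw [IsFormalGroupLaw.powOp, IsFormalGroupLaw.powOp, LinearMap.smul_apply, LinearMap.smul_apply,
      map_smul, map_smul, map_smul, smul_eq_mul, smul_eq_mul, hF.coeff_zero_invOp] at h
    rw [mul_assoc, h, Finset.sum_eq_single α (fun a _ ha => by rw [if_neg ha, mul_zero])
      (fun ha => by rw [Finsupp.notMem_support_iff.mp ha, zero_mul]), if_pos rfl, mul_comm]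

end StandardGroup

/-! ### The congruence topology on `Aut_R(W)`. -/

section AutTopology

open IsLocalRing

variable {R : Type*} [CommRing R] [IsLocalRing R] {W : Type*} [AddCommGroup W] [Module R W]

theorem isOpen_autTopology_preimage (k : ℕ)
    (s : Set (W → W ⧸ (maximalIdeal R ^ k • (⊤ : Submodule R W)))) :
    IsOpen[autTopology R W]
      ((fun (g : W ≃ₗ[R] W) (w : W) => Submodule.Quotient.mk (g w)) ⁻¹' s) :=
  iInf_le (fun k : ℕ => TopologicalSpace.induced
    (fun (g : W ≃ₗ[R] W) (w : W) =>
      (Submodule.Quotient.mk (g w) : W ⧸ (maximalIdeal R ^ k • (⊤ : Submodule R W)))) ⊥) k _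
    ⟨s, trivial, rfl⟩

theorem t2Space_autTopology [IsNoetherianRing R] [Module.Finite R W] :
    @T2Space (W ≃ₗ[R] W) (autTopology R W) := by
  let _ := autTopology R W
  refine ⟨fun f g hfg => ?_⟩
  obtain ⟨w, hw⟩ : ∃ w, f w - g w ≠ 0 := by
    by_contra! h
    exact hfg (LinearEquiv.ext fun w => sub_eq_zero.mp (h w))
  obtain ⟨k, hk⟩ : ∃ k, f w - g w ∉ (maximalIdeal R ^ k • (⊤ : Submodule R W)) := by
    by_contra! h
    exact hw (IsLocalRing.eq_zero_of_forall_mem_pow_smul h)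
  refine ⟨_, _, isOpen_autTopology_preimage k {u | u = fun w => Submodule.Quotient.mk (f w)},
    isOpen_autTopology_preimage k {u | u = fun w => Submodule.Quotient.mk (g w)}, rfl, rfl, ?_⟩
  refine Set.disjoint_left.mpr fun h h1 h2 => hk ?_
  rw [← Submodule.Quotient.eq]
  exact (congrFun (h1.symm.trans h2) w)

theorem continuous_autTopology {X : Type*} [TopologicalSpace X] {φ : X → W ≃ₗ[R] W}
    (h : ∀ k x₀, ∀ᶠ x in 𝓝 x₀, ((φ x : Module.End R W) - (φ x₀ : Module.End R W)) ∈
      (maximalIdeal R ^ k • ⊤ : Submodule R (Module.End R W))) :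
    @Continuous X (W ≃ₗ[R] W) _ (autTopology R W) φ := by
  refine continuous_iInf_rng.mpr fun k => continuous_induced_rng.mpr ?_
  refine @Continuous.mk _ _ _ ⊥ _ fun s _ => isOpen_iff_mem_nhds.mpr fun x₀ hx₀ => ?_
  filter_upwards [h k x₀] with x hx
  have : ((fun (g : W ≃ₗ[R] W) (w : W) => Submodule.Quotient.mk (g w)) ∘ φ) x =
      ((fun (g : W ≃ₗ[R] W) (w : W) =>
        (Submodule.Quotient.mk (g w) : W ⧸ (maximalIdeal R ^ k • (⊤ : Submodule R W)))) ∘ φ) x₀ := by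
    refine funext fun w => (Submodule.Quotient.eq _).mpr ?_
    have hw := Submodule.mem_map_of_mem (f := LinearMap.applyₗ (R := R) (M₂ := W) w) hx
    rw [Submodule.map_smul''] at hw
    exact Submodule.smul_mono le_rfl le_top hw
  rw [Set.mem_preimage, this]
  exact hx₀

end AutTopology

/-! ### Two consequences of compactness. -/

section ModuleTopology

open IsLocalRing

variable {p : ℕ} {R : Type*} [CommRing R] [IsNoetherianRing R] [IsLocalRing R]
  [TopologicalSpace R] [IsTopologicalRing R]

/-- Multiplication by `c` is a continuous injection of a compact Hausdorff space into itself, hence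
an embedding. It yields continuity of `x ^ α / α!` in `x`. -/
theorem IsProPRing.continuous_of_continuous_const_mul [IsDomain R] (hR : IsProPRing p R)
    {X : Type*} [TopologicalSpace X]
    {f : X → R} {c : R} (hc : c ≠ 0) (hf : Continuous fun x => c * f x) : Continuous f := by
  have := hR.compactSpace
  have := hR.t2Space
  exact ((continuous_const.mul continuous_id).isClosedEmbedding
    (mul_right_injective₀ hc)).isEmbedding.continuous_iff.mpr hf

/-- A vector congruent mod `p` to relations that hold modulo all powers of `p` among linearly
independent elements is divisible by `p`. -/
theorem IsProPRing.dvd_of_linearIndependent (hR : IsProPRing p R)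
    {M : Type*} [AddCommGroup M] [Module R M] [Module.Finite R M] [TopologicalSpace M]
    [IsModuleTopology R M] {d : ℕ} {v : Fin d → M} (hv : LinearIndependent R v) {y₀ : Fin d → R}
    (h : ∀ n, ∃ y : Fin d → R, (∀ i, (p : R) ∣ y i - y₀ i) ∧
      ∑ i, y i • v i ∈ LinearMap.range (LinearMap.lsmul R M ((p : R) ^ n))) (i : Fin d) :
    (p : R) ∣ y₀ i := by
  have := hR.compactSpace
  have := hR.t2Space
  have := IsModuleTopology.toContinuousAdd R M
  let C : ℕ → Set (Fin d → R) := fun n => {y | (∀ i, (p : R) ∣ y i - y₀ i) ∧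
      ∑ i, y i • v i ∈ LinearMap.range (LinearMap.lsmul R M ((p : R) ^ n))}
  have hC : ∀ n, IsClosed (C n) := fun n => by
    refine IsClosed.inter ?_ ?_
    · have : {y : Fin d → R | ∀ i, (p : R) ∣ y i - y₀ i} =
          ⋂ i, (fun y : Fin d → R => y i - y₀ i) ⁻¹' (Ideal.span {(p : R)} : Ideal R) := by
        ext y
        simp [Ideal.mem_span_singleton]
      change IsClosed {y : Fin d → R | ∀ i, (p : R) ∣ y i - y₀ i}
      rw [this]
      exact isClosed_iInter fun i => (hR.isClosed_ideal _).preimage (by fun_prop)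
    · exact (hR.isClosed_submodule _).preimage
        (continuous_finsetSum _ fun i _ => (continuous_apply i).smul continuous_const)
  -- The sets `C n` are nested, nonempty and closed in the compact space `R ^ d`. A common point
  -- satisfies the relation modulo every `p ^ n`, hence exactly by Krull's intersection theorem.
  obtain ⟨y, hy⟩ := IsCompact.nonempty_iInter_of_sequence_nonempty_isCompact_isClosed C
    (fun n y hy => ⟨hy.1, by
      obtain ⟨z, hz⟩ := hy.2
      exact ⟨(p : R) • z, by rw [← hz, pow_succ, LinearMap.lsmul_apply, LinearMap.lsmul_apply, mul_smul]⟩⟩)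
    h (hC 0).isCompact hC
  rw [Set.mem_iInter] at hy
  have h0 : ∑ i, y i • v i = 0 := IsLocalRing.eq_zero_of_forall_mem_pow_smul fun k => by
    obtain ⟨z, hz⟩ := (hy k).2
    rw [← hz]
    exact Submodule.smul_mem_smul (Ideal.pow_mem_pow hR.natCast_mem k) trivial
  have := (hy 0).1 i
  rwa [Fintype.linearIndependent_iff.mp hv y h0 i, zero_sub, dvd_neg] at this

end ModuleTopology

/-! ### The homomorphism `Φ` on `G(𝐩R)` and the triviality of its kernel. -/

namespace StandardGroup

open MvPowerSeries Finsupp IsLocalRing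

variable {p : ℕ} {R : Type*} [CommRing R] [IsNoetherianRing R] [IsLocalRing R]
  [TopologicalSpace R] [IsTopologicalRing R] {d : ℕ} {G : Type*} [Group G]
  [TopologicalSpace G]

theorem isCompact_points (S : StandardGroup R d G) (hR : IsProPRing p R) (I : Ideal R) :
    IsCompact (S.points I) := by
  have := hR.compactSpace
  have : CompactSpace (maximalIdeal R) :=
    isCompact_iff_compactSpace.mp (hR.isClosed_ideal _).isCompact
  have : CompactSpace G := S.chart.symm.compactSpace
  refine IsClosed.isCompact ?_
  have : S.points I = ⋂ i, (fun x => S.coord x i) ⁻¹' (I : Set R) := by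
    ext x
    simp [points, coord]
  exact this ▸ isClosed_iInter fun i => (hR.isClosed_ideal I).preimage (S.continuous_coord i)

theorem hasValue_monomial (S : StandardGroup R d G) (α : Fin d →₀ ℕ) (x : G) :
    S.HasValue (monomial α 1) x (α.prod fun i e => S.coord x i ^ e) := by
  classical
  have := hasSum_single (f := fun n => coeff n (monomial α (1 : R)) *
    n.prod fun i e => S.coord x i ^ e) α fun n hn => by rw [coeff_monomial_ne hn, zero_mul]
  rwa [coeff_monomial_same, one_mul] at this

variable [IsDomain R] [CharZero R]

theorem exists_divided_coord (S : StandardGroup R d G) (hR : IsProPRing p R) (hp : p.Prime) {x : G}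
    (hx : x ∈ S.points (Ideal.span {(boldP p : R)})) :
    ∃ X : (Fin d →₀ ℕ) → R,
      (∀ α, (multiFactorial α : R) * X α = α.prod fun i e => S.coord x i ^ e) ∧
      ∀ k α, 2 * k ≤ α.degree → X α ∈ maximalIdeal R ^ k := by
  choose κ hκ e he1 he2 using fun α : Fin d →₀ ℕ => hR.exists_divided_pow hp α
  choose y hy using fun i => Ideal.mem_span_singleton.mp (hx i)
  refine ⟨fun α => κ α * α.prod fun i e => y i ^ e, fun α => ?_, fun k α hk => ?_⟩
  · rw [← mul_assoc, hκ, Finsupp.degree_apply, ← Finset.prod_pow_eq_pow_sum, Finsupp.prod,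
      Finsupp.prod, ← Finset.prod_mul_distrib]
    refine Finset.prod_congr rfl fun i _ => ?_
    rw [← mul_pow, ← hy]
    rfl
  · refine Ideal.mul_mem_right _ _ (Ideal.mem_of_dvd _ (he2 α) ?_)
    exact Ideal.pow_le_pow_right (by have := he1 α; omega)
      (Ideal.pow_mem_pow hR.natCast_mem _)

variable {E : Type*} [Ring E] [Algebra R E] [Module.Finite R E]

/-- The exponential-like homomorphism from `G(𝐩R)` given by the elements `ρ α`. -/
theorem exists_hom (S : StandardGroup R d G) (hR : IsProPRing p R) (hp : p.Prime)
    [TopologicalSpace E] [IsModuleTopology R E]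
    {ρ : (Fin d →₀ ℕ) → E} {e : (Fin d →₀ ℕ) → (Fin d →₀ ℕ) → (Fin d →₀ ℕ) →₀ R}
    (h1 : ρ 0 = 1) (he : ∀ β γ, ρ β * ρ γ = (e β γ).sum fun α r => r • ρ α)
    (hec : ∀ α β γ, (multiFactorial β : R) * multiFactorial γ *
      coeff β (S.isFormalGroupLaw.invOp γ (monomial α 1)) = multiFactorial α * e β γ α) :
    ∃ Φ : S.pointsSubgroup hR (Ideal.span {(boldP p : R)}) →* E,
      (∀ g, ∀ D : (Fin d →₀ ℕ) → R,
        (∀ α, (multiFactorial α : R) * D α = α.prod fun i e => S.coord g.1 i ^ e) →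
        HasSum (fun α => D α • ρ α) (Φ g)) ∧
      ∀ k g₀, ∀ᶠ g in 𝓝 g₀, Φ g - Φ g₀ ∈ (maximalIdeal R ^ k • ⊤ : Submodule R E) := by
  have hEg := IsModuleTopology.topologicalAddGroup R E
  have hE2 := hR.t2Space_module (M := E)
  choose X hX hXk using fun g : S.pointsSubgroup hR (Ideal.span {(boldP p : R)}) =>
    S.exists_divided_coord hR hp g.2
  have hne : ∀ α : Fin d →₀ ℕ, (multiFactorial α : R) ≠ 0 := fun α => by
    exact_mod_cast multiFactorial_ne_zero α
  have hfin : ∀ g k, {α | X g α ∉ maximalIdeal R ^ k}.Finite := fun g k =>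
    (finite_of_degree_lt (2 * k)).subset fun α hα => by
      by_contra h
      exact hα (hXk g k α (not_lt.mp h))
  have hsum : ∀ g, HasSum (fun α => X g α • ρ α) (∑' α, X g α • ρ α) := fun g =>
    (hR.summable_smul hp (hfin g) ρ).hasSum
  have hmul : ∀ g h, ∑' α, X (g * h) α • ρ α = (∑' α, X g α • ρ α) * ∑' α, X h α • ρ α :=
    fun g h => (hsum (g * h)).unique <| hR.hasSum_smul_mul hp multiFactorial_ne_zero he hec
      (hfin g) (hfin h) (fun α => by
        have := S.hasSum_prod_comul hR hp (S.hasValue_monomial α (g.1 * h.1))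
        simp only [hX]
        exact this) (hsum g) (hsum h)
  have hone : ∑' α, X 1 α • ρ α = 1 := by
    refine (hsum 1).unique ?_
    have hX1 : ∀ α, α ≠ 0 → X 1 α = 0 := fun α hα => by
      obtain ⟨i, hi⟩ := Finsupp.ne_iff.mp hα
      have := hX 1 α
      rw [Finsupp.prod, Finset.prod_eq_zero (i := i) (by simpa using hi)] at this
      · exact (mul_eq_zero.mp this).resolve_left (hne α)
      · change S.coord 1 i ^ _ = 0
        rw [coord_one]
        exact zero_pow hi
    have h0 := hX 1 0
    rw [multiFactorial_zero, Nat.cast_one, one_mul, Finsupp.prod_zero_index] at h0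
    have := hasSum_single (f := fun α => X 1 α • ρ α) 0 fun α hα => by rw [hX1 α hα, zero_smul]
    simpa only [h0, h1, one_smul] using this
  refine ⟨⟨⟨fun g => ∑' α, X g α • ρ α, hone⟩, hmul⟩, fun g D hD => ?_, fun k g₀ => ?_⟩
  · have : D = X g := funext fun α => mul_left_cancel₀ (hne α) ((hD α).trans (hX g α).symm)
    exact this ▸ hsum g
  · have hcont : ∀ α, Continuous fun g => X g α := fun α =>
      hR.continuous_of_continuous_const_mul (hne α) <| by
        simp only [hX, Finsupp.prod]
        exact continuous_finsetProd _ fun i _ =>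
          ((S.continuous_coord i).comp continuous_subtype_val).pow _
    -- Modulo `𝔪 ^ k` only the finitely many terms of degree below `2 k` matter, and each
    -- coefficient is continuous in `g`.
    have hev : ∀ᶠ g in 𝓝 g₀, ∀ α ∈ {α : Fin d →₀ ℕ | α.degree < 2 * k},
        X g α - X g₀ α ∈ maximalIdeal R ^ k := by
      refine (Filter.eventually_all_finite (finite_of_degree_lt (2 * k))).mpr fun α _ => ?_
      have hc : Continuous fun g => X g α - X g₀ α := (hcont α).sub continuous_const
      exact hc.continuousAt.eventually_mem
        ((hR.isOpen_pow k).mem_nhds (by simp))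
    filter_upwards [hev] with g hg
    refine ((hsum g).sub (hsum g₀)).mem_of_isClosed (hR.isClosed_submodule _) fun α => ?_
    rw [← sub_smul]
    refine IsProPRing.smul_mem_pow_smul_top ?_ _
    by_cases hα : α.degree < 2 * k
    · exact hg α hα
    · exact sub_mem (hXk g k α (not_lt.mp hα)) (hXk g₀ k α (not_lt.mp hα))

/-- Evaluate at `x ^ (p ^ n)`, with coordinates `p ^ (j + n) y` and `y ≡ y₀` mod `p`. The terms of
degree at least two are divisible by `p ^ (2 (j + n) - 1)`; dividing by `p ^ (j + n)`, which
torsion-freeness permits, shows `∑ y_i ρ e_i` divisible by `p ^ (n + j - 1)`, hence by `p ^ n`. -/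
theorem pow_succ_dvd_coord (S : StandardGroup R d G) (hR : IsProPRing p R) (hp : p.Prime)
    [TopologicalSpace E] [IsModuleTopology R E] [Module.IsTorsionFree R E]
    {ρ : (Fin d →₀ ℕ) → E} (h1 : ρ 0 = 1) (hρ : LinearIndependent R fun i => ρ (single i 1))
    {x : G} (hx : x ∈ S.points (Ideal.span {(boldP p : R)}))
    (h : ∀ n, ∀ D : (Fin d →₀ ℕ) → R,
      (∀ α, (multiFactorial α : R) * D α = α.prod fun i e => S.coord (x ^ n) i ^ e) →
      HasSum (fun α => D α • ρ α) 1)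
    {j : ℕ} (hj : 1 ≤ j) (hj2 : p = 2 → 2 ≤ j) (hxj : ∀ i, (p : R) ^ j ∣ S.coord x i) (i : Fin d) :
    (p : R) ^ (j + 1) ∣ S.coord x i := by
  classical
  have hEg := IsModuleTopology.topologicalAddGroup R E
  have hp0 : (p : R) ≠ 0 := by exact_mod_cast hp.ne_zero
  choose y₀ hy₀ using hxj
  rw [hy₀, pow_succ]
  refine mul_dvd_mul_left _ (hR.dvd_of_linearIndependent hρ (fun n => ?_) i)
  obtain ⟨y, hy, hyy⟩ := S.exists_coord_pow_prime_pow hR hp hj hj2 hy₀ n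
  refine ⟨y, hyy, ?_⟩
  obtain ⟨D, hD, -⟩ := S.exists_divided_coord hR hp
    ((S.pointsSubgroup hR (Ideal.span {(boldP p : R)})).pow_mem hx (p ^ n))
  let T : Finset (Fin d →₀ ℕ) := insert 0 (Finset.univ.image fun i => single i 1)
  have hs := (h _ D hD).sub_sum_mem_of_isClosed (hR.isClosed_submodule
    (LinearMap.range (LinearMap.lsmul R E ((p : R) ^ (2 * (j + n) - 1))))) T fun α hα => by
      have hdeg : 2 ≤ α.degree := by
        by_contra hlt
        by_cases h0 : α = 0
        · exact hα (by simp [T, h0])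
        · have hα' : α.degree ≠ 0 := fun h => h0 ((Finsupp.degree_eq_zero_iff _).mp h)
          obtain ⟨a, rfl⟩ := exists_eq_single_of_degree_eq_one (α := α) (by omega)
          exact hα (by simp [T])
      obtain ⟨c, hc⟩ := hR.pow_dvd_divided_pow hp (hD α) (show 1 ≤ j + n by omega)
        (fun i => ⟨_, hy i⟩) hdeg
      exact ⟨c • ρ α, by rw [hc, mul_smul]; rfl⟩
  have hD0 : D 0 = 1 := by simpa using hD 0
  have hD1 : ∀ i, D (single i 1) = (p : R) ^ (j + n) * y i := fun i => by
    have := hD (single i 1)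
    rwa [multiFactorial_single, Nat.cast_one, one_mul,
      Finsupp.prod_single_index (h := fun i e => S.coord (x ^ p ^ n) i ^ e) (pow_zero _), pow_one,
      hy] at this
  have hT : ∑ α ∈ T, D α • ρ α = 1 + (p : R) ^ (j + n) • ∑ i, y i • ρ (single i 1) := by
    rw [Finset.sum_insert (by simp), Finset.sum_image (single_left_injective one_ne_zero).injOn, hD0, h1,
      one_smul, Finset.smul_sum]
    simp [hD1, mul_smul]
  obtain ⟨z, hz⟩ := hs
  rw [hT, sub_add_cancel_left, show 2 * (j + n) - 1 = (j + n) + (n + (j - 1)) by omega,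
    LinearMap.lsmul_apply, pow_add, mul_smul, ← smul_neg] at hz
  have hz' := smul_right_injective E (pow_ne_zero (j + n) hp0) hz
  exact ⟨-((p : R) ^ (j - 1) • z), by
    rw [map_neg, LinearMap.lsmul_apply, ← mul_smul, ← pow_add, hz', neg_neg]⟩

theorem eq_one_of_forall_hasSum (S : StandardGroup R d G) (hR : IsProPRing p R) (hp : p.Prime)
    [TopologicalSpace E] [IsModuleTopology R E] [Module.IsTorsionFree R E]
    {ρ : (Fin d →₀ ℕ) → E} (h1 : ρ 0 = 1) (hρ : LinearIndependent R fun i => ρ (single i 1))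
    {x : G} (hx : x ∈ S.points (Ideal.span {(boldP p : R)}))
    (h : ∀ n, ∀ D : (Fin d →₀ ℕ) → R,
      (∀ α, (multiFactorial α : R) * D α = α.prod fun i e => S.coord (x ^ n) i ^ e) →
      HasSum (fun α => D α • ρ α) 1) : x = 1 := by
  obtain ⟨j₀, hj₀, hj2, hb⟩ : ∃ j, 1 ≤ j ∧ (p = 2 → 2 ≤ j) ∧ boldP p = p ^ j := by
    by_cases h2 : p = 2
    · exact ⟨2, one_le_two, fun _ => le_rfl, by subst h2; rfl⟩
    · exact ⟨1, le_rfl, fun h => absurd h h2, by rw [boldP, if_neg h2, pow_one]⟩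
  have hdvd : ∀ j, ∀ i, (p : R) ^ (j₀ + j) ∣ S.coord x i := by
    intro j
    induction j with
    | zero =>
      intro i
      have := Ideal.mem_span_singleton.mp (hx i)
      rw [hb] at this
      push_cast at this
      exact this
    | succ j ih =>
      exact S.pow_succ_dvd_coord hR hp h1 hρ hx h (j := j₀ + j) (by omega)
        (fun h => (hj2 h).trans (Nat.le_add_right _ _)) ih
  refine S.coord_injective (funext fun i => ?_)
  rw [coord_one]
  exact hR.eq_zero_of_forall_dvd fun k =>
    (pow_dvd_pow _ (Nat.le_add_left k j₀)).trans (hdvd k i)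

end StandardGroup

/-! ### The closed embedding. -/

theorem mainTheorem10 (p : ℕ) (hp : p.Prime)
    {R : Type*} [CommRing R] [IsDomain R] [IsNoetherianRing R] [IsLocalRing R] [CharZero R]
    [TopologicalSpace R] [IsTopologicalRing R] (hR : IsProPRing p R)
    {d : ℕ} {G : Type*} [Group G] [TopologicalSpace G] (S : StandardGroup R d G)
    {W : Type*} [AddCommGroup W] [Module R W] [Module.Finite R W] [Module.IsTorsionFree R W]
    (hL : ∃ ι : S.lieAlgebra →ₗ⁅R⁆ Module.End R W, Function.Injective ι) :
    ∃ H : Subgroup G, (H : Set G) = S.points (Ideal.span {(boldP p : R)}) ∧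
      ∃ φ : H →* (W ≃ₗ[R] W),
        @Topology.IsClosedEmbedding H (W ≃ₗ[R] W) inferInstance (autTopology R W) φ := by
  obtain ⟨ι, hι⟩ := hL
  let _ : TopologicalSpace (Module.End R W) := moduleTopology R (Module.End R W)
  have : IsModuleTopology R (Module.End R W) := ⟨rfl⟩
  have := hR.t2Space_module (M := Module.End R W)
  obtain ⟨ρ, e, h0, h1, he, hec⟩ := S.exists_extension hR hp ι
  have hρ : LinearIndependent R fun i => ρ (Finsupp.single i 1) := by
    simp only [h1]
    exact (S.linearIndependent_der hR hp).map' (ι : S.lieAlgebra →ₗ[R] Module.End R W)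
      (LinearMap.ker_eq_bot.mpr hι)
  obtain ⟨Φ, hΦ, hΦk⟩ := S.exists_hom hR hp h0 he hec
  refine ⟨S.pointsSubgroup hR (Ideal.span {(boldP p : R)}), rfl,
    (LinearMap.GeneralLinearGroup.generalLinearEquiv R W).toMonoidHom.comp Φ.toHomUnits, ?_⟩
  have : CompactSpace (S.pointsSubgroup hR (Ideal.span {(boldP p : R)})) :=
    isCompact_iff_compactSpace.mp (S.isCompact_points hR _)
  -- `G(𝐩R)` is compact and `Aut_R(W)` is Hausdorff, so continuity and injectivity suffice.
  refine @Continuous.isClosedEmbedding _ _ _ (autTopology R W) _ t2Space_autTopology _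
    (continuous_autTopology hΦk) ?_
  refine (injective_iff_map_eq_one _).mpr fun g hg => ?_
  have hg1 : Φ g = 1 := LinearMap.ext fun w => LinearEquiv.congr_fun hg w
  refine Subtype.ext (S.eq_one_of_forall_hasSum hR hp h0 hρ g.2 fun n D hD => ?_)
  have := hΦ (g ^ n) D hD
  rwa [map_pow, hg1, one_pow] at this
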